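/- **Setting.** Let $d\in\{2,3\}$, $k\ge 1$, let $\Omega\subset\mathbb R^d$ be a bounded Lipschitz domain with a regular (conforming) triangulation $\mathcal T$ into simplices, $\mathcal F^0$ its interior facets, and $(\cdot,\cdot)$ the $L^2(\Omega)$ inner product. Let $V_h^{ct}=P_k(\mathcal T)^d\cap H^1_0(\Omega)^d$ (continuous piecewise polynomials of degree at most $k$), $Q_h=P^{disc}_{k-1}(\mathcal T)\cap L^2_0(\Omega)$ (discontinuous ones of degree at most $k-1$ with mean zero). Let $RT_m(\mathcal T)\subset H(\mathrm{div},\Omega)$ be the Raviart--Thomas space of order $m$ (on each simplex, fields $\boldsymbol p+q\boldsymbol x$ with $\boldsymbol p,q$ polynomial of degree at most $m$), $RT_m^{int}(\mathcal T)$ its subspace of fields with zero normal trace on the boundary of every simplex, and $\widetilde{RT}_{m}^{int}(\mathcal T)$ any fixed complement in $RT_m^{int}(\mathcal T)$ of the divergence-free fields. Let $\widehat Q_h\subseteq Q_h$ be a subspace and $$V_h^R=\begin{cases}RT_0(\mathcal T)\cap H_0(\mathrm{div},\Omega)& k=1,\\ (RT_0(\mathcal T)\cap H_0(\mathrm{div},\Omega))\oplus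 RT_1^{int}(\mathcal T)& k=2,\ d=3,\\ \{v\in\widetilde{RT}_{k-1}^{int}(\mathcal T):\mathrm{div}\,v\perp_{L^2}\widehat Q_h\}& k\ge d.\end{cases}$$ Let $V_h=V_h^{ct}\times V_h^R$ and, for $v=(v^{ct},v^R)$, $v^s=v^{ct}+v^R$. With piecewise derivatives let $$\begin{aligned}d_h(u,v)&=(u^s,v^s),\qquad b(v,q)=-(\mathrm{div}\,v^s,q),\\ c_h^{vol}(w,u,v)&=((w^s\cdot\nabla)u^{ct},v^s)-((w^s\cdot\nabla)v^{ct},u^R),\\ a_h(u,v)&=(\nabla u^{ct},\nabla v^{ct})-(\Delta u^{ct},v^R)+(\Delta v^{ct},u^R)+\alpha\sum_{F\in\mathcal F^0}\mathrm{dof}_F(u^{R})\,\mathrm{dof}_F(v^{R})\,\|\mathrm{div}\,\psi_F\|^2,\end{aligned}$$ where $\psi_F$ are the facet basis functions of $RT_0(\mathcal T)\cap H_0(\mathrm{div},\Omega)$ and $v^R=\sum_F \mathrm{dof}_F(v^R)\psi_F+\widetilde v^R$ with $\widetilde v^R\in RT_{k-1}^{int}(\mathcal T)$. Let $\mathcal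 S(u,v)$ be $(\partial_t u^R,v^R)$ or $(h_{\mathcal T}^{-1}u^R,v^R)$, where $h_{\mathcal T}$ is the piecewise constant function of simplex diameters. Let $\nu,\alpha,\gamma\in\mathbb R$, $T>0$ and $f\in L^2(0,T;L^2(\Omega)^d)$. Let $u_h:[0,T]\to V_h$ be absolutely continuous with given initial value $u_h(0)=u_h^0$, and let $p_h(t)\in Q_h$, such that for almost every $t\in(0,T]$ $$\begin{aligned} d_h(\partial_tu_h,v_h)+c_h^{vol}(u_h,u_h,v_h)+\gamma\mathcal S(u_h,v_h)+\nu a_h(u_h,v_h)+b(v_h,p_h)&=(f,v_h^s)&&\forall v_h\in V_h,\\ b(u_h,q_h)&=0&&\forall q_h\in Q_h.\end{aligned}$$ **Lemma.** Assume that, for almost every $t$, both components of $u_h(t)$, $p_h(t)$ and $f(t)$ have compact support contained in $\Omega_\omega\subseteq\Omega$, and that there is an operator $\chi:L^2(\Omega)^d\to V_h$ with $\chi(g)=(g,0)$ on $\Omega_\omega$ for $g=e_i$ ($1\le i\le d$) and for $g=x\times e_i$, $1\le i\le 3$, if $d=3$, respectively for $g=x\times e_3=(x_2,-x_1)$ if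 $d=2$. Let $$M(u)=\int_\Omega u^s\,dx\in\mathbb R^d,\qquad M_x(u)=\int_\Omega u^s\times x\,dx\in\mathbb R^3,$$ where vectors of $\mathbb R^2$ are extended by a zero third component in cross products. Then $t\mapsto M(u_h(t))$ and $t\mapsto M_x(u_h(t))$ are absolutely continuous on $[0,T]$ and, for almost every $t\in(0,T]$, $$\frac{d}{dt}M(u_h)=\int_\Omega f\,dx,\qquad \frac{d}{dt}M_x(u_h)=\int_\Omega f\times x\,dx .$$ -/

import Mathlib

open MeasureTheory Filter Topology
open scoped ContDiff ENNReal RealInnerProductSpace Classical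

noncomputable section

namespace ScottVogelius

/-- Euclidean space `ℝ^d`. -/
abbrev Vec (d : ℕ) : Type := EuclideanSpace ℝ (Fin d)

variable {d N : ℕ}

/-! ### Domains and triangulations -/

/-- Bounded Lipschitz domain: open, connected, bounded, and near every boundary point the set is
the region below the graph of a Lipschitz function, `ν` being the vertical direction and
`y - ⟪ν, y⟫ ν` the horizontal part of `y`. -/
structure IsBoundedLipschitzDomain (Ω : Set (Vec d)) : Prop where
  isOpen : IsOpen Ω
  isConnected : IsConnected Ω
  isBounded : Bornology.IsBounded Ω
  lipschitz : ∀ x ∈ frontier Ω, ∃ ν : Vec d, ‖ν‖ = 1 ∧ ∃ r > (0 : ℝ), ∃ K : NNReal,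
    ∃ γ : Vec d → ℝ, LipschitzWith K γ ∧
      ∀ y ∈ Metric.ball x r, y ∈ Ω ↔ ⟪ν, y⟫ < γ (y - ⟪ν, y⟫ • ν)

/-- A regular (conforming) triangulation of `Ω` into `N` nondegenerate closed simplices, each given
by the set of its `d + 1` vertices; two simplices meet in the simplex spanned by their common
vertices (a common face, or nothing). -/
structure Triangulation (Ω : Set (Vec d)) (N : ℕ) where
  vert : Fin N → Finset (Vec d)
  vert_injective : Function.Injective vert
  card_vert : ∀ i, (vert i).card = d + 1
  affineIndependent : ∀ i, AffineIndependent ℝ ((↑) : (vert i) → Vec d)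
  inter : ∀ i j, convexHull ℝ (vert i : Set (Vec d)) ∩ convexHull ℝ (vert j : Set (Vec d))
    = convexHull ℝ ((vert i : Set (Vec d)) ∩ (vert j : Set (Vec d)))
  interior_subset : ∀ i, interior (convexHull ℝ (vert i : Set (Vec d))) ⊆ Ω
  cover : ⋃ i, convexHull ℝ (vert i : Set (Vec d)) = closure Ω

/-- The closed simplex with index `i`. -/
def Triangulation.cell {Ω : Set (Vec d)} (𝒯 : Triangulation Ω N) (i : Fin N) : Set (Vec d) :=
  convexHull ℝ (𝒯.vert i : Set (Vec d))

/-- The interior facets. A facet in the interior is shared by exactly two simplices; it is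
recorded as the pair `(i, j)`, `i < j`, of the indices of these simplices. -/
def Triangulation.interiorFacets {Ω : Set (Vec d)} (𝒯 : Triangulation Ω N) :
    Finset (Fin N × Fin N) :=
  Finset.univ.filter fun F => F.1 < F.2 ∧ (𝒯.vert F.1 ∩ 𝒯.vert F.2).card = d

/-- For two simplices `i`, `j` that share a facet, the vertex of simplex `i` opposite to that
facet (the sum below has exactly one term). -/
def Triangulation.opposite {Ω : Set (Vec d)} (𝒯 : Triangulation Ω N) (i j : Fin N) : Vec d :=
  ∑ a ∈ 𝒯.vert i \ 𝒯.vert j, a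

/-! ### Sobolev spaces -/

/-- The (piecewise) divergence of a vector field, by classical derivatives. Here and in the forms
below, the classical derivatives of a piecewise polynomial function exist inside each simplex,
hence almost everywhere, and are there the piecewise derivatives. -/
def pwDiv (v : Vec d → Vec d) (x : Vec d) : ℝ :=
  ∑ j, (fderiv ℝ v x (EuclideanSpace.single j 1)) j

/-- `v ∈ [H^1_0(Ω)]^d`, the closure of the smooth compactly supported fields in the `H^1`-norm
(`G` is then the weak gradient of `v`). -/
def MemH10 (Ω : Set (Vec d)) (v : Vec d → Vec d) : Prop :=
  MemLp v 2 (volume.restrict Ω) ∧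
  ∃ G : Vec d → (Vec d →L[ℝ] Vec d), MemLp G 2 (volume.restrict Ω) ∧
    ∃ φ : ℕ → Vec d → Vec d,
      (∀ n, ContDiff ℝ ∞ (φ n) ∧ HasCompactSupport (φ n) ∧ tsupport (φ n) ⊆ Ω) ∧
      Tendsto (fun n => eLpNorm (fun x => φ n x - v x) 2 (volume.restrict Ω)) atTop (𝓝 0) ∧
      Tendsto (fun n => eLpNorm (fun x => fderiv ℝ (φ n) x - G x) 2 (volume.restrict Ω))
        atTop (𝓝 0)

/-- `v ∈ H(div, Ω)`: `v` and its weak divergence `g` are square integrable. -/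
def MemHdiv (Ω : Set (Vec d)) (v : Vec d → Vec d) : Prop :=
  MemLp v 2 (volume.restrict Ω) ∧
  ∃ g : Vec d → ℝ, MemLp g 2 (volume.restrict Ω) ∧
    ∀ φ : Vec d → ℝ, ContDiff ℝ ∞ φ → HasCompactSupport φ → tsupport φ ⊆ Ω →
      ∫ x in Ω, ⟪v x, gradient φ x⟫ = - ∫ x in Ω, g x * φ x

/-- `v ∈ H_0(div, U)`: `v` lies in `H(div, U)` and its normal trace on `∂U` vanishes, i.e.
Green's formula holds without boundary term for all functions that are smooth up to the
boundary. -/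
def MemHdiv0 (U : Set (Vec d)) (v : Vec d → Vec d) : Prop :=
  MemLp v 2 (volume.restrict U) ∧
  ∃ g : Vec d → ℝ, MemLp g 2 (volume.restrict U) ∧
    ∀ φ : Vec d → ℝ, ContDiff ℝ ∞ φ → HasCompactSupport φ →
      ∫ x in U, ⟪v x, gradient φ x⟫ = - ∫ x in U, g x * φ x

section Spaces

variable {Ω : Set (Vec d)} (𝒯 : Triangulation Ω N)

/-! ### Piecewise polynomial spaces

Elements of the finite element spaces are classes of functions that agree almost everywhere. Each
class is represented by its member that vanishes outside the interiors of the simplices. -/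

/-- The function vanishes outside the interiors of the simplices. -/
def IsNormalized {F : Type*} [Zero F] (v : Vec d → F) : Prop :=
  ∀ x, (∀ i, x ∉ interior (𝒯.cell i)) → v x = 0

/-- The space `P_k^disc(𝒯)` of piecewise polynomials of degree at most `k`. -/
def IsPk (k : ℕ) (q : Vec d → ℝ) : Prop :=
  IsNormalized 𝒯 q ∧
  ∀ i, ∃ p : MvPolynomial (Fin d) ℝ, p.totalDegree ≤ k ∧
    ∀ x ∈ interior (𝒯.cell i), q x = MvPolynomial.eval (fun j => x j) p

/-- The Raviart--Thomas space `RT_k(𝒯)`. -/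
def IsRT (k : ℕ) (v : Vec d → Vec d) : Prop :=
  IsNormalized 𝒯 v ∧ MemHdiv Ω v ∧
  ∀ i, ∃ (p : Fin d → MvPolynomial (Fin d) ℝ) (q : MvPolynomial (Fin d) ℝ),
    (∀ j, (p j).totalDegree ≤ k) ∧ q.totalDegree ≤ k ∧
    ∀ x ∈ interior (𝒯.cell i), ∀ j,
      v x j = MvPolynomial.eval (fun l => x l) (p j) + MvPolynomial.eval (fun l => x l) q * x j

/-- The interior Raviart--Thomas bubbles: zero normal trace on the boundary of every simplex. -/
def IsRTint (k : ℕ) (v : Vec d → Vec d) : Prop :=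
  IsRT 𝒯 k v ∧ ∀ i, MemHdiv0 (interior (𝒯.cell i)) v

/-- Divergence-free interior Raviart--Thomas bubbles. -/
def IsRTint0 (k : ℕ) (v : Vec d → Vec d) : Prop :=
  IsRTint 𝒯 k v ∧ ∀ᵐ x ∂(volume.restrict Ω), pwDiv v x = 0

/-- `W` is an (arbitrary) complement of the divergence-free bubbles in the space of all interior
Raviart--Thomas bubbles of order `k`. -/
structure IsBubbleComplement (k : ℕ) (W : Submodule ℝ (Vec d → Vec d)) : Prop where
  subset : ∀ w ∈ W, IsRTint 𝒯 k w
  disjoint : ∀ w ∈ W, IsRTint0 𝒯 k w → w = 0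
  spanning : ∀ v, IsRTint 𝒯 k v → ∃ z, IsRTint0 𝒯 k z ∧ ∃ w ∈ W, v = z + w

/-! ### Velocity and pressure spaces -/

/-- `V_h^ct`: continuous piecewise polynomials, i.e. `P_k(𝒯)^d ∩ H^1_0(Ω)^d`. -/
def Vct (k : ℕ) : Set (Vec d → Vec d) :=
  {v | (∀ j, IsPk 𝒯 k fun x => v x j) ∧ MemH10 Ω v}

/-- The pressure space `Q_h = P_{k-1}^disc(𝒯) ∩ L^2_0(Ω)`. -/
def Qh (k : ℕ) : Set (Vec d → ℝ) :=
  {q | IsPk 𝒯 (k - 1) q ∧ ∫ x in Ω, q x = 0}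

/-- The Raviart--Thomas enrichment space `V_h^R`; `W` is the chosen complement of the
divergence-free bubbles and `Qhat` the chosen subspace of `Q_h`. -/
def VR (k : ℕ) (W : Submodule ℝ (Vec d → Vec d)) (Qhat : Submodule ℝ (Vec d → ℝ)) :
    Set (Vec d → Vec d) :=
  if k = 1 then {v | IsRT 𝒯 0 v ∧ MemHdiv0 Ω v}
  else if k = 2 ∧ d = 3 then
    {v | ∃ a b, IsRT 𝒯 0 a ∧ MemHdiv0 Ω a ∧ IsRTint 𝒯 1 b ∧ v = a + b}
  else {v | v ∈ W ∧ ∀ q ∈ Qhat, ∫ x in Ω, pwDiv v x * q x = 0}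

end Spaces

/-- Pairs `(v^ct, v^R)` of an `H^1`-conforming and an `H(div)`-conforming component. -/
abbrev Pair (d : ℕ) : Type := (Vec d → Vec d) × (Vec d → Vec d)

/-- `v^s = v^ct + v^R`. -/
def Pair.s (v : Pair d) : Vec d → Vec d := fun x => v.1 x + v.2 x

/-- `V_h = V_h^ct × V_h^R`. -/
def Vh {Ω : Set (Vec d)} (𝒯 : Triangulation Ω N) (k : ℕ) (W : Submodule ℝ (Vec d → Vec d))
    (Qhat : Submodule ℝ (Vec d → ℝ)) : Set (Pair d) :=
  Vct 𝒯 k ×ˢ VR 𝒯 k W Qhat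

/-! ### The forms of the scheme -/

/-- The `L^2(Ω)` inner product of vector fields. -/
def ip (Ω : Set (Vec d)) (u v : Vec d → Vec d) : ℝ := ∫ x in Ω, ⟪u x, v x⟫

/-- `d_h(u, v) = (u^s, v^s)`. -/
def dh (Ω : Set (Vec d)) (u v : Pair d) : ℝ := ip Ω u.s v.s

/-- `b(v, q) = -(div v^s, q)`. -/
def bForm (Ω : Set (Vec d)) (v : Pair d) (q : Vec d → ℝ) : ℝ := - ∫ x in Ω, pwDiv v.s x * q x

/-- `c(w, u, v) = ((w · ∇_h) u, v)`. -/
def cForm (Ω : Set (Vec d)) (w u v : Vec d → Vec d) : ℝ := ∫ x in Ω, ⟪fderiv ℝ u x (w x), v x⟫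

/-- `c_h^vol(w, u, v) = c(w^s, u^ct, v^s) - c(w^s, v^ct, u^R)`. -/
def cVol (Ω : Set (Vec d)) (w u v : Pair d) : ℝ :=
  cForm Ω w.s u.1 v.s - cForm Ω w.s v.1 u.2

/-- `(∇u, ∇v)`, with piecewise gradients. -/
def gradIp (Ω : Set (Vec d)) (u v : Vec d → Vec d) : ℝ :=
  ∫ x in Ω, ∑ j, ⟪fderiv ℝ u x (EuclideanSpace.single j 1),
    fderiv ℝ v x (EuclideanSpace.single j 1)⟫

section Forms

variable {Ω : Set (Vec d)} (𝒯 : Triangulation Ω N)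

/-- The basis function `ψ_F` of `RT_0(𝒯) ∩ H_0(div, Ω)` attached to the interior facet `F` shared
by the simplices `i` and `j`: its flux through `F` from `i` to `j` is one, its flux through every
other facet is zero. -/
def rt0Basis (F : Fin N × Fin N) (x : Vec d) : Vec d :=
  if x ∈ interior (𝒯.cell F.1) then
    (d * volume.real (𝒯.cell F.1))⁻¹ • (x - 𝒯.opposite F.1 F.2)
  else if x ∈ interior (𝒯.cell F.2) then
    - ((d * volume.real (𝒯.cell F.2))⁻¹ • (x - 𝒯.opposite F.2 F.1))
  else 0

/-- `c` holds the lowest order degrees of freedom of `v ∈ V_h^R`: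
`v = ∑_F c_F ψ_F + ṽ` with an interior bubble `ṽ` of order `k - 1`. -/
def IsRT0Dof (k : ℕ) (v : Vec d → Vec d) (c : Fin N × Fin N → ℝ) : Prop :=
  IsRTint 𝒯 (k - 1) (v - ∑ F ∈ 𝒯.interiorFacets, c F • rt0Basis 𝒯 F)

/-- `dof_F(v^{RT_0})`; the coefficients in `IsRT0Dof` exist for every `v ∈ V_h^R`, and those with
`F` an interior facet are unique. -/
def dof (k : ℕ) (v : Vec d → Vec d) (F : Fin N × Fin N) : ℝ :=
  if h : ∃ c, IsRT0Dof 𝒯 k v c then h.choose F else 0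

/-- `a_h^D(u, v) = α ∑_F dof_F(u) dof_F(v) (div ψ_F, div ψ_F)`. -/
def aD (k : ℕ) (α : ℝ) (u v : Vec d → Vec d) : ℝ :=
  α * ∑ F ∈ 𝒯.interiorFacets,
    dof 𝒯 k u F * dof 𝒯 k v F * ∫ x in Ω, pwDiv (rt0Basis 𝒯 F) x * pwDiv (rt0Basis 𝒯 F) x

/-- `a_h(u, v) = (∇u^ct, ∇v^ct) - (Δ_pw u^ct, v^R) + (Δ_pw v^ct, u^R) + a_h^D(u^RT0, v^RT0)`. -/
def ah (k : ℕ) (α : ℝ) (u v : Pair d) : ℝ :=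
  gradIp Ω u.1 v.1 - ip Ω (Laplacian.laplacian u.1) v.2 + ip Ω (Laplacian.laplacian v.1) u.2
    + aD 𝒯 k α u.2 v.2

/-- The two stabilizations. -/
inductive StabKind
  | S1
  | S2

/-- `S_1(u, v) = (∂_t u^R, v^R)` and `S_2(u, v) = (h_𝒯⁻¹ u^R, v^R)`; `u'` stands for `∂_t u`. -/
def stab (u u' v : Pair d) : StabKind → ℝ
  | .S1 => ip Ω u'.2 v.2
  | .S2 => ∑ i, (Metric.diam (𝒯.cell i))⁻¹ * ip (𝒯.cell i) u.2 v.2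

end Forms

/-! ### The semi-discrete scheme -/

/-- The time derivative `∂_t u(t)` of a curve of pairs. -/
def timeDeriv (u : ℝ → Pair d) (t : ℝ) : Pair d :=
  (fun x => deriv (fun s => (u s).1 x) t, fun x => deriv (fun s => (u s).2 x) t)

/-- `u` is an absolutely continuous curve on `[0, T]` in (the finite-dimensional space) `V`:
`u(t) = ∑_j c_j(t) φ_j` with `φ_j ∈ V` and absolutely continuous coefficients. -/
def IsACCurve (V : Set (Pair d)) (T : ℝ) (u : ℝ → Pair d) : Prop :=
  ∃ (n : ℕ) (φ : Fin n → Pair d) (c : Fin n → ℝ → ℝ),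
    (∀ j, φ j ∈ V) ∧ (∀ j, AbsolutelyContinuousOnInterval (c j) 0 T) ∧
    ∀ t ∈ Set.Icc 0 T, u t ∈ V ∧ u t = ∑ j, c j t • φ j

/-- `(u, p)` solves the semi-discrete scheme with the volume form of the convective term on
`(0, T]`, with initial value `u0`; the equations hold at almost every time. -/
structure IsVolSolution {Ω : Set (Vec d)} (𝒯 : Triangulation Ω N) (k : ℕ)
    (W : Submodule ℝ (Vec d → Vec d)) (Qhat : Submodule ℝ (Vec d → ℝ)) (ν α γ : ℝ) (S : StabKind)
    (T : ℝ) (f : ℝ → Lp (Vec d) 2 (volume.restrict Ω)) (u0 : Pair d)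
    (u : ℝ → Pair d) (p : ℝ → Vec d → ℝ) : Prop where
  curve : IsACCurve (Vh 𝒯 k W Qhat) T u
  initial : u 0 = u0
  pressure : ∀ᵐ t ∂(volume.restrict (Set.Ioc 0 T)), p t ∈ Qh 𝒯 k
  momentum : ∀ᵐ t ∂(volume.restrict (Set.Ioc 0 T)), ∀ v ∈ Vh 𝒯 k W Qhat,
    dh Ω (timeDeriv u t) v + cVol Ω (u t) (u t) v + γ * stab 𝒯 (u t) (timeDeriv u t) v S
      + ν * ah 𝒯 k α (u t) v + bForm Ω v (p t) = ip Ω (f t) v.s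
  mass : ∀ᵐ t ∂(volume.restrict (Set.Ioc 0 T)), ∀ q ∈ Qh 𝒯 k, bForm Ω (u t) q = 0

/-! ### Momenta and the fields they are tested with -/

/-- Vectors of `ℝ^d`, `d ≤ 3`, as vectors of `ℝ^3`, filled up with zeros. -/
def to3 (x : Vec d) : Fin 3 → ℝ := fun i => if h : (i : ℕ) < d then x ⟨i, h⟩ else 0

/-- The first `d` components of a vector of `ℝ^3`. -/
def of3 (d : ℕ) (y : Fin 3 → ℝ) : Vec d :=
  WithLp.toLp 2 fun j => if h : (j : ℕ) < 3 then y ⟨j, h⟩ else 0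

/-- Linear momentum `M(u) = ∫ u^s`. -/
def linMom (Ω : Set (Vec d)) (u : Pair d) : Vec d := ∫ x in Ω, u.s x

/-- Angular momentum `M_x(u) = ∫ u^s × x`. -/
def angMom (Ω : Set (Vec d)) (u : Pair d) : Fin 3 → ℝ :=
  ∫ x in Ω, crossProduct (to3 (u.s x)) (to3 x)

/-- The field `x ↦ x × e_i`. -/
def rotField (d : ℕ) (i : Fin 3) (x : Vec d) : Vec d :=
  of3 d (crossProduct (to3 x) (Pi.single i 1))

/-- The operator `χ` reproduces `g` on `Ω₀`: there `χ(g) = (g, 0)`. -/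
def Reproduces {Ω : Set (Vec d)} (χ : Lp (Vec d) 2 (volume.restrict Ω) → Pair d)
    (Ω₀ : Set (Vec d)) (g : Vec d → Vec d) : Prop :=
  ∀ G : Lp (Vec d) 2 (volume.restrict Ω), G =ᵐ[volume.restrict Ω] g →
    ∀ᵐ x ∂(volume.restrict Ω), x ∈ Ω₀ → (χ G).1 x = g x ∧ (χ G).2 x = 0

/-- `v` has compact support contained in `Ω₀` (as an element of a function space on `Ω`). -/
def SupportedOn {F : Type*} [Zero F] (Ω Ω₀ : Set (Vec d)) (v : Vec d → F) : Prop :=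
  ∃ K : Set (Vec d), IsCompact K ∧ K ⊆ Ω₀ ∧ ∀ᵐ x ∂(volume.restrict Ω), x ∉ K → v x = 0

end ScottVogelius

end

open ScottVogelius

/-! The momentum equation is tested with a field that equals `(g, 0)` on `Ω₀`, where `g x = A x + b`
is a rigid body velocity, i.e. `⟪A y, y⟫ = 0`. Every term except the time derivative and the force
then drops out (`ip_eq_of_momentum`). Constant `g` gives linear momentum; `g x = x × e_i` gives
angular momentum, because `(a × x)_i = a · (x × e_i)` (`crossProduct_to3_apply`).

The terms are handled through a pointwise alternative: almost every point lies in `Ω₀`, where `v =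
(g, 0)`, or outside it, where `u`, `∂_t u`, `p` and `f` vanish. Since the derivative of a function
vanishes almost everywhere on its zero set (`ae_fderiv_eq_zero`), the alternative passes to
derivatives: `∇v^ct = A`, `Δv^ct = 0`, `div v^s = tr A = 0` on one side, `∇u^ct = 0`, `Δu^ct = 0` on
the other. This removes the pressure, the stabilization and both Laplacian terms, while `(∇u^ct, A)
= 0` because `u^ct` is in `H^1_0`.

Two terms need more. For convection, the divergence of `u^s` is itself an admissible pressure, so
discrete mass balance makes `u^s` exactly divergence-free (`ae_pwDiv_eq_zero`). Integration by parts
(`integral_convect_eq_zero`) turns the two halves of the volume form into `-(u^ct, A u^s) - (u^R, A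
u^s) = -(u^s, A u^s) = 0`. The facet term involves degrees of freedom, not point values. Polynomials
that vanish on a set of positive measure are zero, so on each cell one of `u^R`, `v^R` vanishes
identically (`eqOn_zero_or_eqOn_zero`), and its degrees of freedom on the facets of that cell are
zero (`IsRT0Dof.eq_zero`).

In time everything is finite-dimensional: the momenta are linear in absolutely continuous
coefficients, and `∂_t u` inherits the support of `u` because being supported in `Ω₀` is a closed
linear condition on the coefficients (`deriv_mem_of_ae_mem`). -/

namespace ScottVogelius

/-! ### Derivatives on zero sets -/

theorem ae_fderiv_eq_zero_of_self {d : ℕ} {f : Vec d → Vec d} {U : Set (Vec d)} (hU : IsOpen U)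
    (hf : DifferentiableOn ℝ f U) : ∀ᵐ x, x ∈ U → f x = 0 → fderiv ℝ f x = 0 := by
  -- The zero set of `f` in `U`, written so that measurability follows from continuity on `U` alone.
  set s := U \ (U ∩ f ⁻¹' {0}ᶜ) with hs
  have hsU : s ⊆ U := Set.sdiff_subset
  have hms : MeasurableSet s := hU.measurableSet.diff
    (hf.continuousOn.isOpen_inter_preimage hU isOpen_compl_singleton).measurableSet
  have h0 : ∀ x ∈ s, f x = 0 := fun x hx => by
    by_contra h
    exact hx.2 ⟨hx.1, h⟩
  -- On its zero set `f` is approximated by the zero map with constant 0; at density points this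
  -- forces the full derivative to vanish.
  have happ : ApproximatesLinearOn f (0 : Vec d →L[ℝ] Vec d) s 0 := by
    intro x hx y hy
    simp [h0 x hx, h0 y hy]
  have := happ.norm_fderiv_sub_le volume hms (fderiv ℝ f) fun x hx =>
    ((hf.differentiableAt (hU.mem_nhds (hsU hx))).hasFDerivAt).hasFDerivWithinAt
  rw [ae_restrict_iff' hms] at this
  filter_upwards [this] with x hx hxU hfx
  have := hx ⟨hxU, fun h => h.2 hfx⟩
  simpa using this

/-- Each coordinate of `f`, multiplied by a fixed unit vector, is a self-map of `Vec d`, to which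
the previous result applies. The unit vector needs `0 < d`. -/
theorem ae_fderiv_eq_zero {d : ℕ} (hd : 0 < d) {F : Type*} [NormedAddCommGroup F] [NormedSpace ℝ F]
    [FiniteDimensional ℝ F] {f : Vec d → F} {U : Set (Vec d)} (hU : IsOpen U)
    (hf : DifferentiableOn ℝ f U) : ∀ᵐ x, x ∈ U → f x = 0 → fderiv ℝ f x = 0 := by
  let b := Module.finBasis ℝ F
  let e : Vec d := EuclideanSpace.single ⟨0, hd⟩ 1
  let ℓ : Fin (Module.finrank ℝ F) → F →L[ℝ] Vec d := fun i =>
    (LinearMap.toContinuousLinearMap (b.coord i)).smulRight e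
  have key : ∀ᵐ x, ∀ i, x ∈ U → (ℓ i ∘ f) x = 0 → fderiv ℝ (ℓ i ∘ f) x = 0 :=
    ae_all_iff.2 fun i =>
      ae_fderiv_eq_zero_of_self hU ((ℓ i).differentiable.comp_differentiableOn hf)
  filter_upwards [key] with x hx hxU hfx
  ext y
  apply b.ext_elem
  intro i
  have h := hx i hxU (by simp [hfx])
  rw [fderiv_comp x (ℓ i).differentiableAt (hf.differentiableAt (hU.mem_nhds hxU)),
    ContinuousLinearMap.fderiv] at h
  have h2 := congrArg (fun L : Vec d →L[ℝ] Vec d => L y ⟨0, hd⟩) h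
  simpa [ℓ, e] using h2

/-! ### Polynomials as functions -/

/-- Evaluation of a polynomial at a point of Euclidean space. -/
noncomputable def polyFun {d : ℕ} (p : MvPolynomial (Fin d) ℝ) (x : Vec d) : ℝ :=
  MvPolynomial.eval (fun j => x j) p

theorem contDiff_polyFun {d : ℕ} (p : MvPolynomial (Fin d) ℝ) : ContDiff ℝ ∞ (polyFun p) := by
  have key : ContDiff ℝ ∞ fun x : Vec d => MvPolynomial.eval (fun j => x j) p := by
    induction p using MvPolynomial.induction_on with
    | C a => simpa using contDiff_const
    | add p q hp hq => simpa using hp.add hq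
    | mul_X p i hp =>
      have : ContDiff ℝ ∞ fun x : Vec d => x i := by fun_prop
      simpa using hp.mul this
  exact key

theorem fderiv_polyFun {d : ℕ} (p : MvPolynomial (Fin d) ℝ) (x : Vec d) (j : Fin d) :
    fderiv ℝ (polyFun p) x (EuclideanSpace.single j 1) = polyFun (MvPolynomial.pderiv j p) x := by
  have hdiff : ∀ q : MvPolynomial (Fin d) ℝ, DifferentiableAt ℝ (polyFun q) x := fun q =>
    (contDiff_polyFun q).differentiable (by simp) x
  induction p using MvPolynomial.induction_on with
  | C a =>
    have : polyFun (MvPolynomial.C a : MvPolynomial (Fin d) ℝ) = fun _ => a := by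
      ext; simp [polyFun]
    rw [this]; simp [polyFun]
  | add p q hp hq =>
    have : polyFun (p + q) = polyFun p + polyFun q := by ext; simp [polyFun]
    rw [this, fderiv_add (hdiff p) (hdiff q)]
    simp only [_root_.add_apply, hp, hq]
    simp [polyFun]
  | mul_X p i hp =>
    have : polyFun (p * MvPolynomial.X i) = fun x => polyFun p x * x i := by ext; simp [polyFun]
    have hc : HasFDerivAt (fun x : Vec d => x i) (EuclideanSpace.proj i : Vec d →L[ℝ] ℝ) x :=
      (EuclideanSpace.proj i : Vec d →L[ℝ] ℝ).hasFDerivAt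
    rw [this, ((hdiff p).hasFDerivAt.fun_mul hc).fderiv]
    simp only [_root_.add_apply, _root_.smul_apply, hp, smul_eq_mul]
    rw [MvPolynomial.pderiv_mul, MvPolynomial.pderiv_X]
    by_cases h : i = j
    · subst h; simp [polyFun]; ring
    · simp [polyFun, h]; ring

theorem totalDegree_pderiv_le {σ : Type*} (p : MvPolynomial σ ℝ) (j : σ) :
    (MvPolynomial.pderiv j p).totalDegree ≤ p.totalDegree - 1 := by
  refine Finset.sup_le fun m hm => ?_
  rw [MvPolynomial.mem_support_iff, MvPolynomial.coeff_pderiv] at hm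
  have h1 : m + Finsupp.single j 1 ∈ p.support := by
    rw [MvPolynomial.mem_support_iff]
    intro h; simp [h] at hm
  have h2 := MvPolynomial.le_totalDegree h1
  have h3 : (m + Finsupp.single j 1).sum (fun _ e => e) = m.sum (fun _ e => e) + 1 := by
    rw [Finsupp.sum_add_index' (by simp) (by simp)]; simp
  omega

/-- Induction on the degree: almost everywhere on the zero set of `p` the partial derivatives vanish
too, and for nonconstant `p` one of them is a nonzero polynomial of smaller degree. -/
theorem ae_polyFun_ne_zero {d : ℕ} (hd : 0 < d) (p : MvPolynomial (Fin d) ℝ) (hp : p ≠ 0) :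
    ∀ᵐ x : Vec d, polyFun p x ≠ 0 := by
  induction hn : p.totalDegree using Nat.strong_induction_on generalizing p with
  | _ n ih =>
    by_cases h : ∃ j, MvPolynomial.pderiv j p ≠ 0
    · obtain ⟨j, hj⟩ := h
      have hdeg : p.totalDegree ≠ 0 := by
        intro h0
        rw [MvPolynomial.totalDegree_eq_zero_iff_eq_C] at h0
        rw [h0] at hj; simp at hj
      have hle := totalDegree_pderiv_le p j
      filter_upwards [ih _ (by omega) _ hj rfl, ae_fderiv_eq_zero hd isOpen_univ
        (contDiff_polyFun p |>.differentiable (by simp)).differentiableOn] with x hx h1 h2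
      apply hx
      rw [← fderiv_polyFun, h1 trivial h2]; simp
    · push Not at h
      have hC : p = MvPolynomial.C (p.coeff 0) := by
        ext m
        rw [MvPolynomial.coeff_C]
        split_ifs with hm
        · rw [hm]
        · obtain ⟨j, hj⟩ : ∃ j, m j ≠ 0 := by
            by_contra! hh; exact hm (by ext j; simp [hh j])
          -- The coefficient of `∂_j p` at `m - e_j` is `m j` times that of `p` at `m`, and `m j ≠
          -- 0` in characteristic zero.
          have := congrArg (MvPolynomial.coeff (m - Finsupp.single j 1)) (h j)
          rw [MvPolynomial.coeff_pderiv, tsub_add_cancel_of_le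
            (by simpa using Nat.one_le_iff_ne_zero.2 hj)] at this
          have h2 : ((m j - 1 : ℕ) : ℝ) + 1 ≠ 0 := by positivity
          simpa [h2] using this
      have h0 : p.coeff 0 ≠ 0 := fun h0 => hp (by rw [hC, h0, map_zero])
      refine Eventually.of_forall fun x => ?_
      rw [hC]; simpa [polyFun] using h0


/-! ### Cells of the triangulation -/

section Cells

variable {d N : ℕ} {Ω : Set (Vec d)} (𝒯 : Triangulation Ω N)

namespace Triangulation

theorem isCompact_cell (i : Fin N) : IsCompact (𝒯.cell i) :=
  (𝒯.vert i).finite_toSet.isCompact_convexHull ℝ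

theorem affineSpan_vert (i : Fin N) : affineSpan ℝ (𝒯.vert i : Set (Vec d)) = ⊤ := by
  have h := (𝒯.affineIndependent i).affineSpan_eq_top_iff_card_eq_finrank_add_one
  have h2 : Set.range ((↑) : 𝒯.vert i → Vec d) = 𝒯.vert i := by simp
  rw [h2] at h
  rw [h]
  simp [𝒯.card_vert i]

/-- The vertices of a cell as an affine basis. -/
noncomputable def basis (i : Fin N) : AffineBasis (𝒯.vert i) ℝ (Vec d) where
  toFun := (↑)
  ind' := 𝒯.affineIndependent i
  tot' := by
    have h2 : Set.range ((↑) : 𝒯.vert i → Vec d) = 𝒯.vert i := by simp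
    rw [h2]; exact 𝒯.affineSpan_vert i

theorem range_basis (i : Fin N) : Set.range (𝒯.basis i) = 𝒯.vert i := by
  have h2 : Set.range ((↑) : 𝒯.vert i → Vec d) = 𝒯.vert i := by simp
  exact h2

theorem nonempty_interior_cell (i : Fin N) : (interior (𝒯.cell i)).Nonempty :=
  interior_convexHull_nonempty_iff_affineSpan_eq_top.2 (𝒯.affineSpan_vert i)

theorem card_inter_le {i j : Fin N} (hij : i ≠ j) : (𝒯.vert i ∩ 𝒯.vert j).card ≤ d := by
  by_contra! h
  have hi : 𝒯.vert i ∩ 𝒯.vert j = 𝒯.vert i :=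
    Finset.eq_of_subset_of_card_le Finset.inter_subset_left (by rw [𝒯.card_vert]; omega)
  have hj : 𝒯.vert i ∩ 𝒯.vert j = 𝒯.vert j :=
    Finset.eq_of_subset_of_card_le Finset.inter_subset_right (by rw [𝒯.card_vert]; omega)
  exact hij (𝒯.vert_injective (hi.symm.trans hj))

/-- Otherwise the simplex on the at most `d` common vertices has interior points, so these vertices
affinely span the space, which takes `d + 1` of them. -/
theorem disjoint_interior {i j : Fin N} (hij : i ≠ j) :
    Disjoint (interior (𝒯.cell i)) (interior (𝒯.cell j)) := by
  rw [Set.disjoint_iff_inter_eq_empty, ← interior_inter]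
  by_contra h
  have hne := Set.nonempty_iff_ne_empty.2 h
  have hin := 𝒯.inter i j
  rw [cell, cell, hin, ← Finset.coe_inter] at hne
  have htop := interior_convexHull_nonempty_iff_affineSpan_eq_top.1 hne
  have := (𝒯.affineIndependent i).card_le_card_of_subset_affineSpan
    (t := 𝒯.vert i ∩ 𝒯.vert j) (by rw [htop]; simp)
  have h2 := 𝒯.card_inter_le hij
  rw [𝒯.card_vert] at this
  omega

theorem ae_mem_cell {i : Fin N} : ∀ᵐ x, x ∈ 𝒯.cell i → x ∈ interior (𝒯.cell i) := by
  have h : volume (frontier (𝒯.cell i)) = 0 := (convex_convexHull ℝ _).addHaar_frontier volume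
  filter_upwards [measure_eq_zero_iff_ae_notMem.1 h] with x hx hxi
  by_contra hn
  exact hx ⟨subset_closure hxi, hn⟩

theorem iUnion_interior_ae_eq : (⋃ i, interior (𝒯.cell i) : Set (Vec d)) =ᵐ[volume] Ω := by
  have h : ∀ᵐ x, ∀ i, x ∈ 𝒯.cell i → x ∈ interior (𝒯.cell i) :=
    ae_all_iff.2 fun i => 𝒯.ae_mem_cell
  filter_upwards [h] with x hx
  apply propext
  refine ⟨fun hU => ?_, fun hΩ => ?_⟩
  · obtain ⟨i, hi⟩ := Set.mem_iUnion.1 hU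
    exact 𝒯.interior_subset i hi
  · have : x ∈ ⋃ i, convexHull ℝ (𝒯.vert i : Set (Vec d)) := 𝒯.cover ▸ subset_closure hΩ
    obtain ⟨i, hi⟩ := Set.mem_iUnion.1 this
    exact Set.mem_iUnion.2 ⟨i, hx i hi⟩

theorem restrict_eq : (volume.restrict Ω : Measure (Vec d)) =
    volume.restrict (⋃ i, interior (𝒯.cell i)) :=
  (Measure.restrict_congr_set 𝒯.iUnion_interior_ae_eq).symm

theorem measurableSet_iUnion_interior : MeasurableSet (⋃ i, interior (𝒯.cell i)) :=
  MeasurableSet.iUnion fun _ => isOpen_interior.measurableSet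

theorem ae_restrict_of_interior {p : Vec d → Prop}
    (h : ∀ i, ∀ᵐ x, x ∈ interior (𝒯.cell i) → p x) : ∀ᵐ x ∂(volume.restrict Ω), p x := by
  rw [𝒯.restrict_eq, ae_restrict_iff' 𝒯.measurableSet_iUnion_interior]
  filter_upwards [ae_all_iff.2 h] with x hx hxU
  obtain ⟨i, hi⟩ := Set.mem_iUnion.1 hxU
  exact hx i hi

theorem ae_interior_of_restrict {p : Vec d → Prop} (h : ∀ᵐ x ∂(volume.restrict Ω), p x)
    (i : Fin N) : ∀ᵐ x, x ∈ interior (𝒯.cell i) → p x := by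
  rw [𝒯.restrict_eq, ae_restrict_iff' 𝒯.measurableSet_iUnion_interior] at h
  filter_upwards [h] with x hx hxi using hx (Set.mem_iUnion.2 ⟨i, hxi⟩)

theorem ae_mem_interior : ∀ᵐ x ∂(volume.restrict Ω), ∃ i, x ∈ interior (𝒯.cell i) :=
  𝒯.ae_restrict_of_interior fun i => Eventually.of_forall fun _ hx => ⟨i, hx⟩

theorem isBounded (𝒯 : Triangulation Ω N) : Bornology.IsBounded Ω := by
  have : IsCompact (⋃ i, 𝒯.cell i) := isCompact_iUnion 𝒯.isCompact_cell
  exact this.isBounded.subset (subset_closure.trans 𝒯.cover.symm.subset)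

theorem isFiniteMeasure (𝒯 : Triangulation Ω N) :
    IsFiniteMeasure (volume.restrict Ω : Measure (Vec d)) :=
  ⟨by rw [Measure.restrict_apply_univ]; exact 𝒯.isBounded.measure_lt_top⟩

theorem setIntegral_eq_sum {E : Type*} [NormedAddCommGroup E] [NormedSpace ℝ E] {F : Vec d → E}
    (hF : IntegrableOn F Ω) : ∫ x in Ω, F x = ∑ i, ∫ x in interior (𝒯.cell i), F x := by
  rw [𝒯.restrict_eq]
  refine integral_iUnion_fintype (fun _ => isOpen_interior.measurableSet)
    (fun i j hij => 𝒯.disjoint_interior hij) fun i => hF.mono_set (𝒯.interior_subset i)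

end Triangulation

/-! ### Piecewise smooth functions -/

/-- The function agrees on each open cell with a smooth function on the whole space. -/
def Pw {E : Type*} [NormedAddCommGroup E] [NormedSpace ℝ E] (F : Vec d → E) : Prop :=
  ∀ i, ∃ P : Vec d → E, ContDiff ℝ ∞ P ∧ Set.EqOn F P (interior (𝒯.cell i))

section Pw

variable {𝒯} {E F G : Type*} [NormedAddCommGroup E] [NormedSpace ℝ E] [NormedAddCommGroup F]
  [NormedSpace ℝ F] [NormedAddCommGroup G] [NormedSpace ℝ G]

theorem _root_.ContDiff.pw {f : Vec d → E} (hf : ContDiff ℝ ∞ f) : Pw 𝒯 f :=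
  fun _ => ⟨f, hf, fun _ _ => rfl⟩

theorem Pw.comp₂ {f : Vec d → E} {g : Vec d → F} {Φ : E × F → G} (hf : Pw 𝒯 f) (hg : Pw 𝒯 g)
    (hΦ : ContDiff ℝ ∞ Φ) : Pw 𝒯 fun x => Φ (f x, g x) := by
  intro i
  obtain ⟨P, hP, hfP⟩ := hf i
  obtain ⟨Q, hQ, hgQ⟩ := hg i
  exact ⟨fun x => Φ (P x, Q x), hΦ.comp (hP.prodMk hQ), fun x hx => by simp [hfP hx, hgQ hx]⟩

theorem Pw.comp {f : Vec d → E} {Φ : E → F} (hf : Pw 𝒯 f) (hΦ : ContDiff ℝ ∞ Φ) :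
    Pw 𝒯 fun x => Φ (f x) := by
  intro i
  obtain ⟨P, hP, hfP⟩ := hf i
  exact ⟨fun x => Φ (P x), hΦ.comp hP, fun x hx => by simp [hfP hx]⟩

theorem Pw.add {f g : Vec d → E} (hf : Pw 𝒯 f) (hg : Pw 𝒯 g) : Pw 𝒯 fun x => f x + g x :=
  hf.comp₂ hg (Φ := fun p => p.1 + p.2) (by fun_prop)

theorem Pw.const_smul {f : Vec d → E} (hf : Pw 𝒯 f) (c : ℝ) : Pw 𝒯 fun x => c • f x :=
  hf.comp (Φ := fun y => c • y) (by fun_prop)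

theorem Pw.inner {f g : Vec d → Vec d} (hf : Pw 𝒯 f) (hg : Pw 𝒯 g) : Pw 𝒯 fun x => ⟪f x, g x⟫ :=
  hf.comp₂ hg (Φ := fun p => ⟪p.1, p.2⟫) contDiff_inner

theorem Pw.mul {f g : Vec d → ℝ} (hf : Pw 𝒯 f) (hg : Pw 𝒯 g) : Pw 𝒯 fun x => f x * g x :=
  hf.comp₂ hg (Φ := fun p => p.1 * p.2) (by fun_prop)

theorem Pw.clm_apply {f : Vec d → E →L[ℝ] F} {g : Vec d → E} (hf : Pw 𝒯 f) (hg : Pw 𝒯 g) :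
    Pw 𝒯 fun x => f x (g x) :=
  hf.comp₂ hg (Φ := fun p : (E →L[ℝ] F) × E => p.1 p.2) (by fun_prop)

theorem Pw.sum {ι : Type*} (s : Finset ι) {f : ι → Vec d → E} (hf : ∀ i ∈ s, Pw 𝒯 (f i)) :
    Pw 𝒯 fun x => ∑ i ∈ s, f i x := by
  induction s using Finset.induction_on with
  | empty => simpa using (contDiff_const (c := (0 : E))).pw
  | insert a s ha ih =>
    simp only [Finset.sum_insert ha]
    exact (hf a (Finset.mem_insert_self a s)).add
      (ih fun i hi => hf i (Finset.mem_insert_of_mem hi))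

theorem fderiv_eqOn {f P : Vec d → E} {U : Set (Vec d)} (hU : IsOpen U) (h : Set.EqOn f P U) :
    Set.EqOn (fderiv ℝ f) (fderiv ℝ P) U := fun _ hx =>
  (h.eventuallyEq_of_mem (hU.mem_nhds hx)).fderiv_eq

theorem Pw.fderiv {f : Vec d → E} (hf : Pw 𝒯 f) : Pw 𝒯 (fderiv ℝ f) := by
  intro i
  obtain ⟨P, hP, hfP⟩ := hf i
  exact ⟨_, hP.fderiv_right (by simp), fderiv_eqOn isOpen_interior hfP⟩

theorem Pw.differentiableAt {f : Vec d → E} (hf : Pw 𝒯 f) {i : Fin N} {x : Vec d}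
    (hx : x ∈ interior (𝒯.cell i)) : DifferentiableAt ℝ f x := by
  obtain ⟨P, hP, hfP⟩ := hf i
  exact (hP.differentiable (by simp) x).congr_of_eventuallyEq
    (hfP.eventuallyEq_of_mem (isOpen_interior.mem_nhds hx))

theorem Pw.pwDiv {v : Vec d → Vec d} (hv : Pw 𝒯 v) : Pw 𝒯 (pwDiv v) := by
  refine Pw.sum Finset.univ (f := fun j x => (_root_.fderiv ℝ v x (EuclideanSpace.single j 1)) j)
    fun j _ => ?_
  exact hv.fderiv.comp (Φ := fun L : Vec d →L[ℝ] Vec d => L (EuclideanSpace.single j 1) j)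
    (by fun_prop)

theorem Pw.aestronglyMeasurable {f : Vec d → E} (hf : Pw 𝒯 f) :
    AEStronglyMeasurable f (volume.restrict Ω) := by
  rw [𝒯.restrict_eq, aestronglyMeasurable_iUnion_iff]
  intro i
  obtain ⟨P, hP, hfP⟩ := hf i
  refine hP.continuous.aestronglyMeasurable.congr ?_
  filter_upwards [ae_restrict_mem isOpen_interior.measurableSet] with x hx using (hfP hx).symm

theorem Pw.exists_bound {f : Vec d → E} (hf : Pw 𝒯 f) :
    ∃ C, ∀ᵐ x ∂(volume.restrict Ω), ‖f x‖ ≤ C := by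
  have h : ∀ i, ∃ C, ∀ x ∈ interior (𝒯.cell i), ‖f x‖ ≤ C := fun i => by
    obtain ⟨P, hP, hfP⟩ := hf i
    obtain ⟨C, hC⟩ := (𝒯.isCompact_cell i).exists_bound_of_continuousOn hP.continuous.continuousOn
    exact ⟨C, fun x hx => hfP hx ▸ hC x (interior_subset hx)⟩
  choose C hC using h
  refine ⟨∑ i, |C i|, ?_⟩
  filter_upwards [𝒯.ae_mem_interior] with x ⟨i, hi⟩
  exact (hC i x hi).trans ((le_abs_self _).trans
    (Finset.single_le_sum (f := fun i => |C i|) (fun _ _ => abs_nonneg _) (Finset.mem_univ i)))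

theorem Pw.memLp {f : Vec d → E} (hf : Pw 𝒯 f) (p : ℝ≥0∞) : MemLp f p (volume.restrict Ω) := by
  have := 𝒯.isFiniteMeasure
  obtain ⟨C, hC⟩ := hf.exists_bound
  exact MemLp.of_bound hf.aestronglyMeasurable C hC

theorem Pw.integrable {f : Vec d → E} (hf : Pw 𝒯 f) : Integrable f (volume.restrict Ω) :=
  memLp_one_iff_integrable.1 (hf.memLp 1)

theorem Pw.ae_fderiv_eq_zero (hd : 0 < d) [FiniteDimensional ℝ E] {f : Vec d → E}
    (hf : Pw 𝒯 f) : ∀ᵐ x ∂(volume.restrict Ω), f x = 0 → _root_.fderiv ℝ f x = 0 :=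
  𝒯.ae_restrict_of_interior fun _ => ScottVogelius.ae_fderiv_eq_zero hd isOpen_interior
    fun _ hx => (hf.differentiableAt hx).differentiableWithinAt

end Pw


/-- A bounded `Φ` and a finite measure turn `L²` convergence into `L¹` convergence. This carries
integral identities from smooth compactly supported fields to their `H^1_0` limits. -/
theorem tendsto_integral_clm_of_eLpNorm {X E F : Type*} [MeasurableSpace X] {μ : Measure X}
    [IsFiniteMeasure μ] [NormedAddCommGroup E] [NormedSpace ℝ E] [NormedAddCommGroup F]
    [NormedSpace ℝ F] {f : ℕ → X → E} {g : X → E} (hf : ∀ n, MemLp (f n) 2 μ) (hg : MemLp g 2 μ)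
    (h : Tendsto (fun n => eLpNorm (fun x => f n x - g x) 2 μ) atTop (𝓝 0))
    {Φ : X → E →L[ℝ] F} (hΦ : AEStronglyMeasurable Φ μ) {C : ℝ} (hC : ∀ᵐ x ∂μ, ‖Φ x‖ ≤ C) :
    Tendsto (fun n => ∫ x, Φ x (f n x) ∂μ) atTop (𝓝 (∫ x, Φ x (g x) ∂μ)) := by
  have hint : ∀ k : X → E, MemLp k 2 μ → Integrable (fun x => Φ x (k x)) μ := fun k hk =>
    (hk.integrable one_le_two).norm.const_mul C |>.mono'
      (isBoundedBilinearMap_apply.continuous.comp_aestronglyMeasurable (hΦ.prodMk hk.1)) (by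
      filter_upwards [hC] with x hx
      exact ((Φ x).le_opNorm _).trans (by gcongr))
  refine tendsto_integral_of_L1' _ (hint g hg).1 (Eventually.of_forall fun n => hint _ (hf n)) ?_
  have hle : ∀ n, eLpNorm ((fun x => Φ x (f n x)) - fun x => Φ x (g x)) 1 μ ≤
      ENNReal.ofReal C * (eLpNorm (fun x => f n x - g x) 2 μ *
        μ Set.univ ^ (1 / (1 : ℝ≥0∞).toReal - 1 / (2 : ℝ≥0∞).toReal)) := fun n => by
    refine (eLpNorm_le_mul_eLpNorm_of_ae_le_mul (g := fun x => f n x - g x) (c := C) ?_ 1).trans ?_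
    · filter_upwards [hC] with x hx
      simp only [Pi.sub_apply, ← map_sub]
      exact ((Φ x).le_opNorm _).trans (by gcongr)
    · gcongr
      exact eLpNorm_le_eLpNorm_mul_rpow_measure_univ one_le_two ((hf n).1.sub hg.1)
  refine tendsto_of_tendsto_of_tendsto_of_le_of_le tendsto_const_nhds ?_ (fun _ => zero_le) hle
  have hfin : μ Set.univ ^ (1 / (1 : ℝ≥0∞).toReal - 1 / (2 : ℝ≥0∞).toReal) ≠ ⊤ :=
    ENNReal.rpow_ne_top_of_nonneg (by norm_num) (measure_ne_top μ _)
  have h1 := ENNReal.Tendsto.mul_const h (Or.inr hfin)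
  have h2 := ENNReal.Tendsto.const_mul (a := ENNReal.ofReal C) h1 (Or.inr ENNReal.ofReal_ne_top)
  simpa using h2

end Cells

variable {d N : ℕ} {Ω : Set (Vec d)} {𝒯 : Triangulation Ω N}

/-! ### Integration by parts and weak divergences -/

theorem inner_gradient_eq (v : Vec d → Vec d) (φ : Vec d → ℝ) (x : Vec d) :
    ⟪v x, gradient φ x⟫ = fderiv ℝ φ x (v x) := by
  rw [real_inner_comm]; exact inner_gradient_left

theorem clm_apply_eq_sum {E : Type*} [NormedAddCommGroup E] [NormedSpace ℝ E] (L : Vec d →L[ℝ] E)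
    (y : Vec d) : L y = ∑ j, y j • L (EuclideanSpace.single j 1) := by
  conv_lhs => rw [← (EuclideanSpace.basisFun (Fin d) ℝ).sum_repr y]
  simp [map_sum]

theorem fderiv_coord {v : Vec d → Vec d} {x : Vec d} (hv : DifferentiableAt ℝ v x) (j : Fin d)
    (y : Vec d) : fderiv ℝ (fun x => v x j) x y = fderiv ℝ v x y j := by
  have := ((EuclideanSpace.proj j : Vec d →L[ℝ] ℝ).hasFDerivAt.comp x hv.hasFDerivAt).fderiv
  simpa [Function.comp_def] using congrArg (fun L : Vec d →L[ℝ] ℝ => L y) this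

/-- Integration by parts for smooth functions one of which is compactly supported. -/
theorem integral_fderiv_apply_eq_neg {v : Vec d → Vec d} {φ : Vec d → ℝ} (hv : ContDiff ℝ ∞ v)
    (hφ : ContDiff ℝ ∞ φ) (hs : HasCompactSupport φ ∨ HasCompactSupport v) :
    ∫ x, fderiv ℝ φ x (v x) = - ∫ x, pwDiv v x * φ x := by
  have hvd : Differentiable ℝ v := hv.differentiable (by simp)
  have hφd : Differentiable ℝ φ := hφ.differentiable (by simp)
  have hc1 : Continuous (fderiv ℝ φ) := hφ.continuous_fderiv (by simp)
  have hc2 : Continuous (fderiv ℝ v) := hv.continuous_fderiv (by simp)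
  have hvc := hv.continuous
  have hφc := hφ.continuous
  have hi1 : ∀ j, Integrable fun x => v x j * fderiv ℝ φ x (EuclideanSpace.single j 1) := by
    intro j
    refine Continuous.integrable_of_hasCompactSupport (by fun_prop) ?_
    rcases hs with hs | hs
    · exact (hs.fderiv ℝ).mono' (subset_closure.trans' fun x hx => by
        simp only [Function.mem_support] at hx ⊢
        intro h0; apply hx; simp [h0])
    · exact hs.mono' (subset_closure.trans' fun x hx => by
        simp only [Function.mem_support] at hx ⊢
        intro h0; apply hx; simp [h0])
  have hi2 : ∀ j, Integrable fun x => fderiv ℝ v x (EuclideanSpace.single j 1) j * φ x := by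
    intro j
    refine Continuous.integrable_of_hasCompactSupport (by fun_prop) ?_
    rcases hs with hs | hs
    · exact hs.mono' (subset_closure.trans' fun x hx => by
        simp only [Function.mem_support] at hx ⊢
        intro h0; apply hx; simp [h0])
    · exact (hs.fderiv ℝ).mono' (subset_closure.trans' fun x hx => by
        simp only [Function.mem_support] at hx ⊢
        intro h0; apply hx; simp [h0])
  have hi3 : ∀ j, Integrable fun x => v x j * φ x := fun j => by
    refine Continuous.integrable_of_hasCompactSupport (by fun_prop) ?_
    rcases hs with hs | hs <;>
    exact hs.mono' (subset_closure.trans' fun x hx => by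
        simp only [Function.mem_support] at hx ⊢
        intro h0; apply hx; simp [h0])
  calc ∫ x, fderiv ℝ φ x (v x)
      = ∫ x, ∑ j, v x j * fderiv ℝ φ x (EuclideanSpace.single j 1) := by
        congr 1; ext x; rw [clm_apply_eq_sum]; rfl
    _ = ∑ j, ∫ x, v x j * fderiv ℝ φ x (EuclideanSpace.single j 1) :=
        integral_finsetSum _ fun j _ => hi1 j
    _ = ∑ j, - ∫ x, fderiv ℝ v x (EuclideanSpace.single j 1) j * φ x := by
        refine Finset.sum_congr rfl fun j _ => ?_
        have := integral_mul_fderiv_eq_neg_fderiv_mul_of_integrable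
          (μ := (volume : Measure (Vec d)))
          (f := fun x => v x j) (g := φ) (v := EuclideanSpace.single j 1)
          (by simpa only [fderiv_coord (hvd _)] using hi2 j) (hi1 j) (hi3 j)
          (fun x _ => by fun_prop) (fun x _ => hφd x)
        simpa only [fderiv_coord (hvd _)] using this
    _ = - ∫ x, pwDiv v x * φ x := by
        rw [Finset.sum_neg_distrib, ← integral_finsetSum _ fun j _ => hi2 j]
        simp only [pwDiv, Finset.sum_mul]

theorem fderiv_eq_zero_of_notMem_tsupport {E : Type*} [NormedAddCommGroup E] [NormedSpace ℝ E]
    {φ : Vec d → E} {x : Vec d} (hx : x ∉ tsupport φ) : fderiv ℝ φ x = 0 :=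
  Function.notMem_support.1 fun h => hx (support_fderiv_subset ℝ h)

theorem pwDiv_eqOn {v P : Vec d → Vec d} {U : Set (Vec d)} (hU : IsOpen U) (h : Set.EqOn v P U) :
    Set.EqOn (pwDiv v) (pwDiv P) U := fun x hx => by
  simp only [pwDiv, fderiv_eqOn hU h hx]

/-- A weak divergence agrees on each cell with the classical one. -/
theorem ae_eq_pwDiv {v : Vec d → Vec d} (hv : Pw 𝒯 v) {U : Set (Vec d)} {i : Fin N}
    (hU : interior (𝒯.cell i) ⊆ U) {g : Vec d → ℝ} (hg : IntegrableOn g U)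
    (h : ∀ φ : Vec d → ℝ, ContDiff ℝ ∞ φ → HasCompactSupport φ →
      tsupport φ ⊆ interior (𝒯.cell i) →
      ∫ x in U, ⟪v x, gradient φ x⟫ = - ∫ x in U, g x * φ x) :
    ∀ᵐ x, x ∈ interior (𝒯.cell i) → g x = pwDiv v x := by
  obtain ⟨P, hP, hvP⟩ := hv i
  have hcd : Continuous (pwDiv P) := by
    have : Continuous (fderiv ℝ P) := hP.continuous_fderiv (by simp)
    unfold pwDiv; fun_prop
  -- Fundamental lemma of the calculus of variations on the open cell, where test functions see only
  -- the smooth representative `P`.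
  have key := isOpen_interior.ae_eq_zero_of_integral_contDiff_smul_eq_zero
    (μ := (volume : Measure (Vec d))) (U := interior (𝒯.cell i)) (f := fun x => g x - pwDiv P x)
    ((hg.mono_set hU).locallyIntegrableOn.sub (hcd.locallyIntegrable.locallyIntegrableOn _)) ?_
  · filter_upwards [key] with x hx hxi
    rw [pwDiv_eqOn isOpen_interior hvP hxi]
    linarith [hx hxi]
  intro φ hφ hφs hφi
  have h1 : ∫ x in U, ⟪v x, gradient φ x⟫ = ∫ x, fderiv ℝ φ x (P x) := by
    rw [setIntegral_eq_integral_of_forall_compl_eq_zero]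
    · congr 1; ext x
      rw [inner_gradient_eq]
      by_cases hx : x ∈ tsupport φ
      · rw [hvP (hφi hx)]
      · simp [fderiv_eq_zero_of_notMem_tsupport hx]
    · intro x hx
      rw [inner_gradient_eq, fderiv_eq_zero_of_notMem_tsupport fun h => hx (hU (hφi h))]; simp
  have h2 : ∫ x in U, g x * φ x = ∫ x, g x * φ x :=
    setIntegral_eq_integral_of_forall_compl_eq_zero fun x hx => by
      rw [image_eq_zero_of_notMem_tsupport fun h => hx (hU (hφi h)), mul_zero]
  have h3 := integral_fderiv_apply_eq_neg hP hφ (Or.inl hφs)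
  have h4 := h φ hφ hφs hφi
  rw [h1, h2, h3, neg_inj] at h4
  have hi1 : Integrable fun x => g x * φ x := by
    obtain ⟨C, hC⟩ := hφs.exists_bound_of_continuous hφ.continuous
    have : IntegrableOn (fun x => g x * φ x) U := Integrable.mul_bdd (c := C) hg
      hφ.continuous.aestronglyMeasurable (Eventually.of_forall hC)
    refine (integrableOn_iff_integrable_of_support_subset fun x hx => ?_).1 this
    by_contra hxU
    exact hx (by simp [image_eq_zero_of_notMem_tsupport fun h => hxU (hU (hφi h))])
  have hi2 : Integrable fun x => pwDiv P x * φ x :=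
    Continuous.integrable_of_hasCompactSupport (hcd.mul hφ.continuous) hφs.mul_left
  have : (fun x => φ x • (g x - pwDiv P x)) = fun x => g x * φ x - pwDiv P x * φ x := by
    ext x; simp; ring
  rw [this, integral_sub hi1 hi2, h4, sub_self]

/-! ### Divergence and normal trace in the finite element spaces -/

/-- On each open cell the field is polynomial, with divergence of degree at most `m`. -/
def HasPolyDiv (𝒯 : Triangulation Ω N) (m : ℕ) (v : Vec d → Vec d) : Prop :=
  ∀ i, ∃ P : Fin d → MvPolynomial (Fin d) ℝ,
    (∑ j, MvPolynomial.pderiv j (P j)).totalDegree ≤ m ∧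
      ∀ x ∈ interior (𝒯.cell i), ∀ j, v x j = polyFun (P j) x

theorem HasPolyDiv.mono {m n : ℕ} (hmn : m ≤ n) {v : Vec d → Vec d} (hv : HasPolyDiv 𝒯 m v) :
    HasPolyDiv 𝒯 n v := fun i => by
  obtain ⟨P, hP, hvP⟩ := hv i
  exact ⟨P, hP.trans hmn, hvP⟩

theorem HasPolyDiv.add {m : ℕ} {v w : Vec d → Vec d} (hv : HasPolyDiv 𝒯 m v)
    (hw : HasPolyDiv 𝒯 m w) : HasPolyDiv 𝒯 m (fun x => v x + w x) := fun i => by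
  obtain ⟨P, hP, hvP⟩ := hv i
  obtain ⟨Q, hQ, hwQ⟩ := hw i
  refine ⟨P + Q, ?_, fun x hx j => ?_⟩
  · simp only [Pi.add_apply, map_add, Finset.sum_add_distrib]
    exact (MvPolynomial.totalDegree_add _ _).trans (max_le hP hQ)
  · simp [hvP x hx, hwQ x hx, polyFun]

theorem HasPolyDiv.pw {m : ℕ} {v : Vec d → Vec d} (hv : HasPolyDiv 𝒯 m v) : Pw 𝒯 v := fun i => by
  obtain ⟨P, -, hvP⟩ := hv i
  refine ⟨fun x => WithLp.toLp 2 fun j => polyFun (P j) x, ?_, fun x hx => ?_⟩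
  · rw [contDiff_euclidean]
    exact fun j => contDiff_polyFun (P j)
  · ext j; exact hvP x hx j

theorem HasPolyDiv.pwDiv {m : ℕ} {v : Vec d → Vec d} (hv : HasPolyDiv 𝒯 m v) (i : Fin N) :
    ∃ p : MvPolynomial (Fin d) ℝ, p.totalDegree ≤ m ∧
      ∀ x ∈ interior (𝒯.cell i), pwDiv v x = polyFun p x := by
  obtain ⟨P, hP, hvP⟩ := hv i
  refine ⟨_, hP, fun x hx => ?_⟩
  have hsum : polyFun (∑ j, MvPolynomial.pderiv j (P j)) x =
      ∑ j, polyFun (MvPolynomial.pderiv j (P j)) x := by simp [polyFun, map_sum]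
  rw [hsum, ScottVogelius.pwDiv]
  refine Finset.sum_congr rfl fun j _ => ?_
  rw [← fderiv_polyFun, ← fderiv_coord (hv.pw.differentiableAt hx)]
  have : Set.EqOn (fun x => v x j) (polyFun (P j)) (interior (𝒯.cell i)) := fun y hy => hvP y hy j
  rw [fderiv_eqOn isOpen_interior this hx]

theorem totalDegree_pderiv_mul_X_le (p : MvPolynomial (Fin d) ℝ) (j : Fin d) :
    (MvPolynomial.pderiv j p * MvPolynomial.X j).totalDegree ≤ p.totalDegree := by
  rcases Nat.eq_zero_or_pos p.totalDegree with h | h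
  · rw [MvPolynomial.totalDegree_eq_zero_iff_eq_C] at h
    rw [h]; simp
  · have h1 := MvPolynomial.totalDegree_mul (MvPolynomial.pderiv j p) (MvPolynomial.X j)
    have h2 := totalDegree_pderiv_le p j
    have h3 := MvPolynomial.totalDegree_X (R := ℝ) j
    omega

/-- The components may have degree `m + 1`, but `∂_j (q x_j) = ∂_j q · x_j + q` has degree at most
`m`. Hence divergences fit the pressure degree. -/
theorem IsRT.hasPolyDiv {m : ℕ} {v : Vec d → Vec d} (hv : IsRT 𝒯 m v) : HasPolyDiv 𝒯 m v := by
  intro i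
  obtain ⟨p, q, hp, hq, h⟩ := hv.2.2 i
  refine ⟨fun j => p j + q * MvPolynomial.X j, ?_, fun x hx j => ?_⟩
  · refine MvPolynomial.totalDegree_finsetSum_le fun j _ => ?_
    rw [map_add, MvPolynomial.pderiv_mul, MvPolynomial.pderiv_X_self, mul_one]
    have h1 := totalDegree_pderiv_le (p j) j
    have h2 := totalDegree_pderiv_mul_X_le q j
    have h3 := hp j
    refine (MvPolynomial.totalDegree_add _ _).trans (max_le (by omega) ?_)
    exact (MvPolynomial.totalDegree_add _ _).trans (max_le (by omega) hq)
  · rw [h x hx j]; simp [polyFun]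

theorem Vct.hasPolyDiv {k : ℕ} {v : Vec d → Vec d} (hv : v ∈ Vct 𝒯 k) :
    HasPolyDiv 𝒯 (k - 1) v := by
  intro i
  choose p hp h using fun j => (hv.1 j).2 i
  refine ⟨p, MvPolynomial.totalDegree_finsetSum_le fun j _ => ?_, fun x hx j => h j x hx⟩
  have := totalDegree_pderiv_le (p j) j
  have := hp j
  omega

/-- Green's formula on `Ω` without boundary term, with the piecewise divergence. -/
def HasDiv0 (Ω : Set (Vec d)) (v : Vec d → Vec d) : Prop :=
  ∀ φ : Vec d → ℝ, ContDiff ℝ ∞ φ → HasCompactSupport φ →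
    ∫ x in Ω, fderiv ℝ φ x (v x) = - ∫ x in Ω, pwDiv v x * φ x

theorem Pw.fderiv_apply {v : Vec d → Vec d} (hv : Pw 𝒯 v) {φ : Vec d → ℝ} (hφ : ContDiff ℝ ∞ φ) :
    Pw 𝒯 fun x => _root_.fderiv ℝ φ x (v x) :=
  Pw.clm_apply (hφ.fderiv_right (m := ∞) (by simp)).pw hv

theorem pwDiv_add {v w : Vec d → Vec d} (hv : Pw 𝒯 v) (hw : Pw 𝒯 w) {i : Fin N} {x : Vec d}
    (hx : x ∈ interior (𝒯.cell i)) : pwDiv (fun x => v x + w x) x = pwDiv v x + pwDiv w x := by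
  simp only [pwDiv, ← Finset.sum_add_distrib]
  refine Finset.sum_congr rfl fun j _ => ?_
  rw [fderiv_fun_add (hv.differentiableAt hx) (hw.differentiableAt hx)]
  simp

theorem HasDiv0.add {v w : Vec d → Vec d} (hv : HasDiv0 Ω v) (hw : HasDiv0 Ω w) (hvp : Pw 𝒯 v)
    (hwp : Pw 𝒯 w) : HasDiv0 Ω (fun x => v x + w x) := by
  intro φ hφ hφs
  simp only [map_add]
  rw [integral_add (hvp.fderiv_apply hφ).integrable (hwp.fderiv_apply hφ).integrable,
    hv φ hφ hφs, hw φ hφ hφs, ← neg_add, ← integral_add (hvp.pwDiv.mul hφ.pw).integrable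
    (hwp.pwDiv.mul hφ.pw).integrable]
  congr 1
  refine integral_congr_ae ?_
  filter_upwards [𝒯.ae_mem_interior] with x ⟨i, hx⟩
  rw [pwDiv_add hvp hwp hx, add_mul]

/-- Test functions supported in a single cell identify the weak divergence with the classical one.
-/
theorem MemHdiv0.hasDiv0 {v : Vec d → Vec d} (hv : MemHdiv0 Ω v) (hvp : Pw 𝒯 v) : HasDiv0 Ω v := by
  have := 𝒯.isFiniteMeasure
  obtain ⟨-, g, hg, h⟩ := hv
  have hge : ∀ᵐ x ∂(volume.restrict Ω), g x = pwDiv v x := 𝒯.ae_restrict_of_interior fun i =>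
    ae_eq_pwDiv hvp (𝒯.interior_subset i) (hg.integrable one_le_two)
      fun φ hφ hφs _ => h φ hφ hφs
  intro φ hφ hφs
  have := h φ hφ hφs
  simp only [inner_gradient_eq] at this
  rw [this]
  congr 1
  refine integral_congr_ae ?_
  filter_upwards [hge] with x hx
  rw [hx]

theorem MemHdiv0.hasDiv0_cell {v : Vec d → Vec d} {i : Fin N}
    (hv : MemHdiv0 (interior (𝒯.cell i)) v) (hvp : Pw 𝒯 v) : HasDiv0 (interior (𝒯.cell i)) v := by
  have : IsFiniteMeasure (volume.restrict (interior (𝒯.cell i)) : Measure (Vec d)) :=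
    ⟨by rw [Measure.restrict_apply_univ]
        exact ((𝒯.isCompact_cell i).isBounded.subset interior_subset).measure_lt_top⟩
  obtain ⟨-, g, hg, h⟩ := hv
  have hge := ae_eq_pwDiv hvp subset_rfl (hg.integrable one_le_two)
      fun φ hφ hφs _ => h φ hφ hφs
  intro φ hφ hφs
  have := h φ hφ hφs
  simp only [inner_gradient_eq] at this
  rw [this]
  congr 1
  refine integral_congr_ae ?_
  rw [EventuallyEq, ae_restrict_iff' isOpen_interior.measurableSet]
  filter_upwards [hge] with x hx hxi
  rw [hx hxi]

/-- Sum of the Green formulas of the cells, none of which has a boundary term. -/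
theorem IsRTint.hasDiv0 {m : ℕ} {v : Vec d → Vec d} (hv : IsRTint 𝒯 m v) : HasDiv0 Ω v := by
  have hvp := hv.1.hasPolyDiv.pw
  intro φ hφ hφs
  rw [𝒯.setIntegral_eq_sum (hvp.fderiv_apply hφ).integrable,
    𝒯.setIntegral_eq_sum (hvp.pwDiv.mul hφ.pw).integrable, ← Finset.sum_neg_distrib]
  exact Finset.sum_congr rfl fun i _ => (hv.2 i).hasDiv0_cell hvp φ hφ hφs

/-- The common features of the three enrichment spaces on which the argument rests: a divergence of
pressure degree and no normal flux through `∂Ω`. -/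
theorem VR.props {k : ℕ} {W : Submodule ℝ (Vec d → Vec d)} (hW : IsBubbleComplement 𝒯 (k - 1) W)
    {Qhat : Submodule ℝ (Vec d → ℝ)} {v : Vec d → Vec d} (hv : v ∈ VR 𝒯 k W Qhat) :
    HasPolyDiv 𝒯 (k - 1) v ∧ HasDiv0 Ω v := by
  unfold VR at hv
  split_ifs at hv with h1 h2
  · have := hv.1.hasPolyDiv
    exact ⟨this.mono (Nat.zero_le _), hv.2.hasDiv0 this.pw⟩
  · obtain ⟨a, b, ha, ha0, hb, rfl⟩ := hv
    have hap := ha.hasPolyDiv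
    have hbp := hb.1.hasPolyDiv
    exact ⟨(hap.mono (Nat.zero_le _)).add (hbp.mono (by omega)),
      (ha0.hasDiv0 hap.pw).add hb.hasDiv0 hap.pw hbp.pw⟩
  · have := hW.subset v hv.1
    exact ⟨this.1.hasPolyDiv, this.hasDiv0⟩

theorem hasCompactSupport_memLp {E : Type*} [NormedAddCommGroup E] {φ : Vec d → E}
    (hφ : Continuous φ) (hs : HasCompactSupport φ) : MemLp φ 2 (volume.restrict Ω) :=
  (hφ.memLp_of_hasCompactSupport hs).restrict Ω

theorem setIntegral_eq_of_tsupport {E F : Type*} [NormedAddCommGroup E] [NormedAddCommGroup F]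
    [NormedSpace ℝ F] {φ : Vec d → E} (hφ : tsupport φ ⊆ Ω) {f : Vec d → F}
    (h : ∀ x, x ∉ tsupport φ → f x = 0) : ∫ x in Ω, f x = ∫ x, f x :=
  setIntegral_eq_integral_of_forall_compl_eq_zero fun x hx => h x fun hx' => hx (hφ hx')

/-- The weak gradient of an `H^1_0` field agrees with the piecewise gradient. -/
theorem MemH10.exists_seq {v : Vec d → Vec d} (hv : MemH10 Ω v) (hvp : Pw 𝒯 v) :
    ∃ φ : ℕ → Vec d → Vec d,
      (∀ n, ContDiff ℝ ∞ (φ n) ∧ HasCompactSupport (φ n) ∧ tsupport (φ n) ⊆ Ω) ∧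
      Tendsto (fun n => eLpNorm (fun x => φ n x - v x) 2 (volume.restrict Ω)) atTop (𝓝 0) ∧
      Tendsto (fun n => eLpNorm (fun x => fderiv ℝ (φ n) x - fderiv ℝ v x) 2 (volume.restrict Ω))
        atTop (𝓝 0) := by
  have := 𝒯.isFiniteMeasure
  obtain ⟨hvm, G, hG, φ, hφ, h0, h1⟩ := hv
  refine ⟨φ, hφ, h0, ?_⟩
  suffices hGv : ∀ᵐ x ∂(volume.restrict Ω), G x = fderiv ℝ v x by
    refine h1.congr fun n => eLpNorm_congr_ae ?_
    filter_upwards [hGv] with x hx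
    rw [hx]
  refine 𝒯.ae_restrict_of_interior fun i => ?_
  obtain ⟨P, hP, hvP⟩ := hvp i
  have hPd : Continuous (fderiv ℝ P) := hP.continuous_fderiv (by simp)
  have hj : ∀ j, ∀ᵐ x, x ∈ interior (𝒯.cell i) → G x (EuclideanSpace.single j 1) -
      fderiv ℝ P x (EuclideanSpace.single j 1) = 0 := by
    intro j
    set e : Vec d := EuclideanSpace.single j 1 with he
    have hGi : Integrable (fun x => G x e) (volume.restrict Ω) :=
      (ContinuousLinearMap.apply ℝ (Vec d) e).integrable_comp (hG.integrable one_le_two)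
    refine isOpen_interior.ae_eq_zero_of_integral_contDiff_smul_eq_zero
      (μ := (volume : Measure (Vec d))) ?_ ?_
    · have hGo : IntegrableOn (fun x => G x e) Ω := hGi
      refine (hGo.mono_set (𝒯.interior_subset i)).locallyIntegrableOn.sub ?_
      exact (Continuous.locallyIntegrable (by fun_prop)).locallyIntegrableOn _
    intro ψ hψ hψs hψi
    have hψΩ := hψi.trans (𝒯.interior_subset i)
    have hψd : Continuous (fderiv ℝ ψ) := hψ.continuous_fderiv (by simp)
    have hψc := hψ.continuous
    have ibp : ∀ f : Vec d → Vec d, ContDiff ℝ ∞ f →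
        ∫ x, ψ x • fderiv ℝ f x e = - ∫ x, fderiv ℝ ψ x e • f x := fun f hf => by
      have hfd : Continuous (fderiv ℝ f) := hf.continuous_fderiv (by simp)
      have hfc := hf.continuous
      refine integral_smul_fderiv_eq_neg_fderiv_smul_of_integrable ?_ ?_ ?_
        (fun x _ => hψ.differentiable (by simp) x) (fun x _ => hf.differentiable (by simp) x)
      · exact Continuous.integrable_of_hasCompactSupport (by fun_prop)
          ((hψs.fderiv_apply ℝ e).smul_right)
      · exact Continuous.integrable_of_hasCompactSupport (by fun_prop) hψs.smul_right
      · exact Continuous.integrable_of_hasCompactSupport (by fun_prop) hψs.smul_right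
    obtain ⟨C, hC⟩ := hψs.exists_bound_of_continuous hψc
    obtain ⟨C', hC'⟩ := (hψs.fderiv_apply ℝ e).exists_bound_of_continuous (by fun_prop)
    have lim1 := tendsto_integral_clm_of_eLpNorm (μ := volume.restrict Ω)
      (fun n => hasCompactSupport_memLp ((hφ n).1.continuous_fderiv (by simp))
        ((hφ n).2.1.fderiv ℝ)) hG h1
      (Φ := fun x => ψ x • ContinuousLinearMap.apply ℝ (Vec d) e)
      (C := C * ‖ContinuousLinearMap.apply ℝ (Vec d) e‖)
      (Continuous.aestronglyMeasurable (by fun_prop))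
      (Eventually.of_forall fun x => by rw [norm_smul]; gcongr; exact hC x)
    have lim2 := tendsto_integral_clm_of_eLpNorm (μ := volume.restrict Ω)
      (fun n => hasCompactSupport_memLp (hφ n).1.continuous (hφ n).2.1) hvm h0
      (Φ := fun x => fderiv ℝ ψ x e • ContinuousLinearMap.id ℝ (Vec d))
      (C := C' * ‖ContinuousLinearMap.id ℝ (Vec d)‖)
      (Continuous.aestronglyMeasurable (by fun_prop))
      (Eventually.of_forall fun x => by rw [norm_smul]; gcongr; exact hC' x)
    have hz1 : ∀ f : Vec d → Vec d →L[ℝ] Vec d, ∀ x, x ∉ tsupport ψ → ψ x • f x e = 0 :=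
      fun f x hx => by rw [image_eq_zero_of_notMem_tsupport hx, zero_smul]
    have hz2 : ∀ f : Vec d → Vec d, ∀ x, x ∉ tsupport ψ → fderiv ℝ ψ x e • f x = 0 :=
      fun f x hx => by rw [fderiv_eq_zero_of_notMem_tsupport hx]; simp
    simp only [_root_.smul_apply, ContinuousLinearMap.apply_apply,
      ContinuousLinearMap.id_apply] at lim1 lim2
    -- In the limit `G` becomes the distributional gradient of `v`. On the cell `v` is the smooth
    -- `P`, so `G` and `fderiv ℝ P` have the same integrals against `ψ`.
    have heq : ∀ n, ∫ x in Ω, ψ x • fderiv ℝ (φ n) x e =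
        - ∫ x in Ω, fderiv ℝ ψ x e • φ n x := fun n => by
      rw [setIntegral_eq_of_tsupport hψΩ (hz1 _), setIntegral_eq_of_tsupport hψΩ (hz2 _)]
      exact ibp _ (hφ n).1
    have hG' : ∫ x in Ω, ψ x • G x e = - ∫ x in Ω, fderiv ℝ ψ x e • v x :=
      tendsto_nhds_unique (lim1.congr heq) lim2.neg
    rw [setIntegral_eq_of_tsupport hψΩ (hz1 _), setIntegral_eq_of_tsupport hψΩ (hz2 _)] at hG'
    have hvP' : ∫ x, fderiv ℝ ψ x e • v x = ∫ x, fderiv ℝ ψ x e • P x := by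
      congr 1; ext1 x
      by_cases hx : x ∈ tsupport ψ
      · rw [hvP (hψi hx)]
      · rw [hz2 _ x hx, hz2 _ x hx]
    rw [hvP', ← ibp P hP] at hG'
    have hi1 : Integrable fun x => ψ x • G x e := by
      have : IntegrableOn (fun x => ψ x • G x e) Ω := Integrable.bdd_smul hGi C
        hψc.aestronglyMeasurable (Eventually.of_forall hC)
      refine (integrableOn_iff_integrable_of_support_subset fun x hx => ?_).1 this
      by_contra hxU
      exact hx (hz1 _ x fun h => hxU (hψΩ h))
    have hi2 : Integrable fun x => ψ x • fderiv ℝ P x e :=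
      Continuous.integrable_of_hasCompactSupport (by fun_prop) hψs.smul_right
    simp only [smul_sub]
    rw [integral_sub hi1 hi2, hG', sub_self]
  filter_upwards [ae_all_iff.2 hj] with x hx hxi
  rw [fderiv_eqOn isOpen_interior hvP hxi]
  ext1 y
  rw [clm_apply_eq_sum, clm_apply_eq_sum (fderiv ℝ P x)]
  exact Finset.sum_congr rfl fun j _ => by rw [sub_eq_zero.1 (hx j hxi)]

/-- The test function `ψ` may reach the boundary; it is the approximating fields that are compactly
supported in `Ω`. Passing to their limit avoids any discussion of jumps across facets. -/
theorem MemH10.hasDiv0 {v : Vec d → Vec d} (hv : MemH10 Ω v) (hvp : Pw 𝒯 v) : HasDiv0 Ω v := by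
  have := 𝒯.isFiniteMeasure
  obtain ⟨φ, hφ, h0, h1⟩ := hv.exists_seq hvp
  intro ψ hψ hψs
  have hψc := hψ.continuous
  have hψd : Continuous (fderiv ℝ ψ) := hψ.continuous_fderiv (by simp)
  obtain ⟨C, hC⟩ := hψs.exists_bound_of_continuous hψc
  obtain ⟨C', hC'⟩ := (hψs.fderiv ℝ).exists_bound_of_continuous hψd
  have lim1 := tendsto_integral_clm_of_eLpNorm (μ := volume.restrict Ω)
    (fun n => hasCompactSupport_memLp (hφ n).1.continuous (hφ n).2.1) (hvp.memLp 2) h0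
    (Φ := fderiv ℝ ψ) hψd.aestronglyMeasurable (Eventually.of_forall hC')
  let D : (Vec d →L[ℝ] Vec d) →L[ℝ] ℝ := ∑ j, (EuclideanSpace.proj j : Vec d →L[ℝ] ℝ) ∘L
    ContinuousLinearMap.apply ℝ (Vec d) (EuclideanSpace.single j 1)
  have hD : ∀ (f : Vec d → Vec d) x, D (fderiv ℝ f x) = pwDiv f x := fun f x => by
    simp [D, pwDiv]
  have lim2 := tendsto_integral_clm_of_eLpNorm (μ := volume.restrict Ω)
    (fun n => hasCompactSupport_memLp ((hφ n).1.continuous_fderiv (by simp))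
      ((hφ n).2.1.fderiv ℝ)) (hvp.fderiv.memLp 2) h1
    (Φ := fun x => ψ x • D) (C := C * ‖D‖) (Continuous.aestronglyMeasurable (by fun_prop))
    (Eventually.of_forall fun x => by rw [norm_smul]; gcongr; exact hC x)
  simp only [_root_.smul_apply, hD, smul_eq_mul] at lim2
  have heq : ∀ n, ∫ x in Ω, fderiv ℝ ψ x (φ n x) = - ∫ x in Ω, ψ x * pwDiv (φ n) x := fun n => by
    rw [setIntegral_eq_of_tsupport (hφ n).2.2, setIntegral_eq_of_tsupport (hφ n).2.2,
      integral_fderiv_apply_eq_neg (hφ n).1 hψ (Or.inl hψs)]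
    · simp only [mul_comm]
    · intro x hx
      simp [pwDiv, fderiv_eq_zero_of_notMem_tsupport hx]
    · intro x hx
      rw [image_eq_zero_of_notMem_tsupport hx, map_zero]
  rw [tendsto_nhds_unique (lim1.congr heq) lim2.neg]
  simp only [mul_comm]

/-- Makes constants and linear functions available as test functions in Green's formula, which asks
for compact support. -/
theorem exists_cutoff {S : Set (Vec d)} (hS : Bornology.IsBounded S) :
    ∃ φ : Vec d → ℝ, ContDiff ℝ ∞ φ ∧ HasCompactSupport φ ∧
      ∀ x ∈ S, φ x = 1 ∧ fderiv ℝ φ x = 0 := by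
  obtain ⟨R, hR, hSR⟩ := hS.subset_ball_lt 0 0
  let b : ContDiffBump (0 : Vec d) := ⟨R, R + 1, hR, by linarith⟩
  refine ⟨b, b.contDiff, b.hasCompactSupport, fun x hx => ?_⟩
  have h1 : (b : Vec d → ℝ) =ᶠ[𝓝 x] fun _ => 1 :=
    b.eventuallyEq_one_of_mem_ball (hSR hx)
  exact ⟨h1.eq_of_nhds, by rw [h1.fderiv_eq]; simp⟩

theorem HasDiv0.integral_pwDiv_eq_zero {U : Set (Vec d)} (hUm : MeasurableSet U)
    (hU : Bornology.IsBounded U) {v : Vec d → Vec d} (hv : HasDiv0 U v) :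
    ∫ x in U, pwDiv v x = 0 := by
  obtain ⟨φ, hφ, hφs, h1⟩ := exists_cutoff hU
  have h := hv φ hφ hφs
  have e1 : ∫ x in U, fderiv ℝ φ x (v x) = 0 := by
    rw [setIntegral_congr_fun hUm (g := fun _ => (0 : ℝ)) fun x hx => by simp [(h1 x hx).2]]
    simp
  have e2 : ∫ x in U, pwDiv v x * φ x = ∫ x in U, pwDiv v x :=
    setIntegral_congr_fun hUm fun x hx => by simp [(h1 x hx).1]
  linarith

/-! ### Exact incompressibility and the convective form -/

/-- The discrete mass balance gives an exactly divergence-free velocity. -/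
theorem ae_pwDiv_eq_zero (hΩ : MeasurableSet Ω) {k : ℕ} {v : Vec d → Vec d}
    (hv : HasPolyDiv 𝒯 (k - 1) v) (hv0 : HasDiv0 Ω v)
    (h : ∀ q ∈ Qh 𝒯 k, ∫ x in Ω, pwDiv v x * q x = 0) :
    ∀ᵐ x ∂(volume.restrict Ω), pwDiv v x = 0 := by
  -- The divergence itself as pressure test function, normalized to zero off the open cells: its
  -- degree fits, and its mean is zero by Green's formula. Testing with it gives `∫ (div v)² = 0`.
  let q : Vec d → ℝ := fun x => if ∃ i, x ∈ interior (𝒯.cell i) then pwDiv v x else 0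
  have hqv : ∀ᵐ x ∂(volume.restrict Ω), q x = pwDiv v x := by
    filter_upwards [𝒯.ae_mem_interior] with x hx
    simp only [q, if_pos hx]
  have hq : q ∈ Qh 𝒯 k := by
    refine ⟨⟨fun x hx => if_neg (by simpa using hx), fun i => ?_⟩, ?_⟩
    · obtain ⟨p, hp, h⟩ := hv.pwDiv i
      exact ⟨p, hp, fun x hx => (if_pos (⟨i, hx⟩ : ∃ i, x ∈ interior (𝒯.cell i))).trans (h x hx)⟩
    · rw [integral_congr_ae hqv]
      exact hv0.integral_pwDiv_eq_zero hΩ 𝒯.isBounded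
  have hz := h q hq
  have hsq : ∫ x in Ω, pwDiv v x * pwDiv v x = 0 := by
    rw [← hz]
    refine integral_congr_ae ?_
    filter_upwards [hqv] with x hx
    rw [hx]
  have := (integral_eq_zero_iff_of_nonneg (fun x => mul_self_nonneg (pwDiv v x))
    (hv.pw.pwDiv.mul hv.pw.pwDiv).integrable).1 hsq
  filter_upwards [this] with x hx
  exact mul_self_eq_zero.1 hx

/-- Integration by parts of the convective form against an affine field. -/
theorem integral_convect_eq_zero {v w : Vec d → Vec d} (hv : MemH10 Ω v) (hvp : Pw 𝒯 v)
    (hwp : Pw 𝒯 w) (hw : ∀ φ : Vec d → ℝ, ContDiff ℝ ∞ φ → HasCompactSupport φ → tsupport φ ⊆ Ω →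
      ∫ x in Ω, fderiv ℝ φ x (w x) = 0) (A : Vec d →L[ℝ] Vec d) (b : Vec d) :
    ∫ x in Ω, ⟪fderiv ℝ v x (w x), A x + b⟫ = - ∫ x in Ω, ⟪v x, A (w x)⟫ := by
  have := 𝒯.isFiniteMeasure
  obtain ⟨φ, hφ, h0, h1⟩ := hv.exists_seq hvp
  have hg : Pw 𝒯 fun x => A x + b := ContDiff.pw (by fun_prop)
  have hap : ContDiff ℝ ∞ fun y : Vec d =>
      (ContinuousLinearMap.apply ℝ (Vec d) y : (Vec d →L[ℝ] Vec d) →L[ℝ] Vec d) := by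
    fun_prop
  have hΦ1 : Pw 𝒯 fun x => (innerSL ℝ (A x + b)) ∘L ContinuousLinearMap.apply ℝ (Vec d) (w x) :=
    hg.comp₂ hwp (Φ := fun p : Vec d × Vec d =>
      (innerSL ℝ p.1) ∘L ContinuousLinearMap.apply ℝ (Vec d) p.2)
      (ContDiff.clm_comp ((innerSL ℝ).contDiff.comp contDiff_fst)
        (hap.comp contDiff_snd))
  have hΦ2 : Pw 𝒯 fun x => innerSL ℝ (A (w x)) :=
    hwp.comp (Φ := fun y => innerSL ℝ (A y)) ((innerSL ℝ).contDiff.comp A.contDiff)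
  obtain ⟨C, hC⟩ := hΦ1.exists_bound
  obtain ⟨C', hC'⟩ := hΦ2.exists_bound
  have hm0 : ∀ n, MemLp (φ n) 2 (volume.restrict Ω) := fun n =>
    hasCompactSupport_memLp (hφ n).1.continuous (hφ n).2.1
  have hm1 : ∀ n, MemLp (fderiv ℝ (φ n)) 2 (volume.restrict Ω) := fun n =>
    hasCompactSupport_memLp ((hφ n).1.continuous_fderiv (by simp)) ((hφ n).2.1.fderiv ℝ)
  have lim1 := tendsto_integral_clm_of_eLpNorm hm1 (hvp.fderiv.memLp 2) h1
    hΦ1.aestronglyMeasurable hC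
  have lim2 := tendsto_integral_clm_of_eLpNorm hm0 (hvp.memLp 2) h0
    hΦ2.aestronglyMeasurable hC'
  simp only [ContinuousLinearMap.comp_apply, ContinuousLinearMap.apply_apply,
    innerSL_apply_apply] at lim1 lim2
  -- The weak divergence-freeness of `w` is tested with the scalar `⟪A x + b, φ n x⟫`; the product
  -- rule yields the two integrals.
  have heq : ∀ n, ∫ x in Ω, ⟪A x + b, fderiv ℝ (φ n) x (w x)⟫ =
      - ∫ x in Ω, ⟪A (w x), φ n x⟫ := fun n => by
    have hpn : Pw 𝒯 (φ n) := (hφ n).1.pw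
    have hd : ContDiff ℝ ∞ fun x => ⟪A x + b, φ n x⟫ :=
      ContDiff.inner ℝ (by fun_prop) (hφ n).1
    have hsub : tsupport (fun x => ⟪A x + b, φ n x⟫) ⊆ tsupport (φ n) :=
      closure_mono fun x hx => by
        simp only [Function.mem_support] at hx ⊢
        intro h0; apply hx; rw [h0, inner_zero_right]
    have key := hw _ hd ((hφ n).2.1.of_isClosed_subset (isClosed_tsupport _) hsub)
      (hsub.trans (hφ n).2.2)
    have hfd : ∀ x, fderiv ℝ (fun x => ⟪A x + b, φ n x⟫) x (w x) =
        ⟪A x + b, fderiv ℝ (φ n) x (w x)⟫ + ⟪A (w x), φ n x⟫ := fun x => by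
      rw [fderiv_inner_apply ℝ (by fun_prop) ((hφ n).1.differentiable (by simp) x)]
      congr 2
      rw [fderiv_add_const, A.fderiv]
    simp only [hfd] at key
    rw [integral_add (hg.inner (hpn.fderiv.clm_apply hwp)).integrable
      (Pw.inner (hwp.comp A.contDiff) hpn).integrable] at key
    linarith
  have := tendsto_nhds_unique (lim1.congr heq) lim2.neg
  simpa only [real_inner_comm] using this

theorem laplacian_eq_zero {f : Vec d → Vec d} {x : Vec d} (h : fderiv ℝ (fderiv ℝ f) x = 0) :
    Laplacian.laplacian f x = 0 := by
  rw [InnerProductSpace.laplacian_eq_iteratedFDeriv_stdOrthonormalBasis]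
  simp [iteratedFDeriv_two_apply, h]

/-- Where a piecewise smooth field agrees with an affine one, so do almost everywhere its
derivatives. -/
theorem Pw.ae_eq_affine (hd : 0 < d) {v : Vec d → Vec d} (hv : Pw 𝒯 v) (A : Vec d →L[ℝ] Vec d)
    (b : Vec d) : ∀ᵐ x ∂(volume.restrict Ω), v x = A x + b →
      _root_.fderiv ℝ v x = A ∧ Laplacian.laplacian v x = 0 := by
  have hg : Pw 𝒯 fun x => -(A x + b) := ContDiff.pw (by fun_prop)
  -- The zero set principle is used twice: for `v - (A x + b)`, then for `∇v - A`.
  have h1 := (hv.add hg).ae_fderiv_eq_zero hd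
  have hA : Pw 𝒯 fun _ : Vec d => -A := ContDiff.pw contDiff_const
  have h2 := (hv.fderiv.add hA).ae_fderiv_eq_zero hd
  filter_upwards [h1, h2, 𝒯.ae_mem_interior] with x h1 h2 ⟨i, hx⟩ hvx
  have e1 : _root_.fderiv ℝ v x = A := by
    have := h1 (by rw [hvx]; abel)
    rw [fderiv_fun_add (hv.differentiableAt hx) (by fun_prop), fderiv_fun_neg, fderiv_add_const,
      A.fderiv] at this
    exact (add_neg_eq_zero.1 this)
  refine ⟨e1, laplacian_eq_zero ?_⟩
  have := h2 (by rw [e1]; abel)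
  rwa [fderiv_add_const] at this

/-! ### Neighbouring cells -/

namespace Triangulation

/-- Two cells that share a facet lie on opposite sides of it. -/
theorem coord_neg {i j : Fin N} (hij : i ≠ j) {S : Finset (Vec d)} {a b : Vec d} (ha : a ∉ S)
    (hb : b ∉ S) (hS : S.Nonempty) (hi : 𝒯.vert i = insert a S) (hj : 𝒯.vert j = insert b S)
    (hai : a ∈ 𝒯.vert i) : (𝒯.basis i).coord ⟨a, hai⟩ b < 0 := by
  by_contra! hpos
  have hab : a ≠ b := fun h => hij (𝒯.vert_injective (by rw [hi, hj, h]))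
  have hbj : b ∈ 𝒯.vert j := hj ▸ Finset.mem_insert_self _ _
  have hSi : ∀ s ∈ S, s ∈ 𝒯.vert i := fun s hs => hi ▸ Finset.mem_insert_of_mem hs
  have hSj : ∀ s ∈ S, s ∈ 𝒯.vert j := fun s hs => hj ▸ Finset.mem_insert_of_mem hs
  -- The barycentre of the shared facet: its coordinates in cell `i` are positive, except that only
  -- nonnegativity is claimed at `a`.
  set m : Vec d := S.centerMass (fun _ => (1 : ℝ)) id with hm
  have hcard : (0 : ℝ) < S.card := by exact_mod_cast hS.card_pos
  have hmS : m ∈ convexHull ℝ (S : Set (Vec d)) :=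
    Finset.centerMass_mem_convexHull _ (fun _ _ => zero_le_one) (by simpa using hcard)
      fun s hs => hs
  have hcoord : ∀ s : 𝒯.vert i, 0 ≤ (𝒯.basis i).coord s m ∧
      (s ≠ ⟨a, hai⟩ → 0 < (𝒯.basis i).coord s m) := by
    intro s
    have hms : (𝒯.basis i).coord s m = ∑ t ∈ S, (S.card : ℝ)⁻¹ * (𝒯.basis i).coord s t := by
      have h1 : m = S.affineCombination ℝ id fun _ => (S.card : ℝ)⁻¹ := by
        rw [Finset.affineCombination_eq_linear_combination _ _ _ (by simp [hcard.ne'])]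
        simp [hm, Finset.centerMass, Finset.smul_sum]
      rw [h1, Finset.map_affineCombination _ _ _ (by simp [hcard.ne']),
        Finset.affineCombination_eq_linear_combination _ _ _ (by simp [hcard.ne'])]
      simp
    have hst : ∀ t ∈ S, 0 ≤ (S.card : ℝ)⁻¹ * (𝒯.basis i).coord s t := fun t ht => by
      have : (𝒯.basis i).coord s t = if s = ⟨t, hSi t ht⟩ then 1 else 0 :=
        (𝒯.basis i).coord_apply s ⟨t, hSi t ht⟩
      rw [this]; split_ifs <;> positivity
    rw [hms]
    refine ⟨Finset.sum_nonneg hst, fun hsa => ?_⟩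
    have hsS : (s : Vec d) ∈ S := by
      have := Finset.mem_insert.1 ((Finset.ext_iff.1 hi s).1 s.2)
      exact this.resolve_left fun h => hsa (Subtype.ext h)
    refine Finset.sum_pos' hst ⟨s, hsS, ?_⟩
    have : (𝒯.basis i).coord s (s : Vec d) = 1 := (𝒯.basis i).coord_apply_eq s
    rw [this]; positivity
  -- If the `a`-coordinate of `b` were nonnegative, a short move from `m` towards `b` would stay in
  -- cell `i`. The point reached is in both cells, hence in the hull of `S`, yet its `b`-coordinate
  -- in cell `j` is `ε > 0`.
  have hev : ∀ᶠ ε : ℝ in 𝓝[>] 0, ∀ s : 𝒯.vert i,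
      0 ≤ (𝒯.basis i).coord s (AffineMap.lineMap m b ε) := by
    rw [eventually_all]
    intro s
    by_cases hs : s = ⟨a, hai⟩
    · filter_upwards [self_mem_nhdsWithin, Ioo_mem_nhdsGT (zero_lt_one (α := ℝ))] with ε hε hε1
      rw [AffineMap.apply_lineMap, AffineMap.lineMap_apply_module, hs]
      have h1 := (hcoord ⟨a, hai⟩).1
      have h2 : (0 : ℝ) < ε := hε
      have h3 := hε1.2
      simp only [smul_eq_mul]
      exact add_nonneg (mul_nonneg (by linarith) h1) (mul_nonneg h2.le hpos)
    · have hc : Continuous fun ε : ℝ => (𝒯.basis i).coord s (AffineMap.lineMap m b ε) := by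
        simp only [AffineMap.apply_lineMap]
        simp only [AffineMap.lineMap_apply_module]
        fun_prop
      have h0 := hc.tendsto 0
      simp only [AffineMap.lineMap_apply_zero] at h0
      have := h0.eventually (lt_mem_nhds ((hcoord s).2 hs))
      exact (this.filter_mono nhdsWithin_le_nhds).mono fun ε h => h.le
  obtain ⟨ε, hε, hε0, hε1⟩ := (hev.and (Ioo_mem_nhdsGT (zero_lt_one (α := ℝ)))).exists
  set x : Vec d := AffineMap.lineMap m b ε with hx
  have hxi : x ∈ convexHull ℝ (𝒯.vert i : Set (Vec d)) := by
    rw [← 𝒯.range_basis i, (𝒯.basis i).convexHull_eq_nonneg_coord]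
    exact hε
  have hxj : x ∈ convexHull ℝ (𝒯.vert j : Set (Vec d)) :=
    (convex_convexHull ℝ _).lineMap_mem (convexHull_mono (fun s hs => hSj s hs) hmS)
      (subset_convexHull ℝ _ hbj) ⟨hε0.le, hε1.le⟩
  have hinter : (𝒯.vert i : Set (Vec d)) ∩ 𝒯.vert j ⊆ S := by
    rintro s ⟨h1, h2⟩
    rw [hi] at h1
    rw [hj] at h2
    simp only [Finset.coe_insert, Set.mem_insert_iff, Finset.mem_coe] at h1 h2 ⊢
    rcases h1 with rfl | h1
    · exact h2.resolve_left hab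
    · exact h1
  have hzero : ∀ y ∈ convexHull ℝ (S : Set (Vec d)), (𝒯.basis j).coord ⟨b, hbj⟩ y = 0 := by
    have hconv : Convex ℝ ((𝒯.basis j).coord ⟨b, hbj⟩ ⁻¹' {0}) :=
      (convex_singleton 0).affine_preimage _
    refine fun y hy => convexHull_min (fun s hs => ?_) hconv hy
    exact (𝒯.basis j).coord_apply_ne (i := ⟨b, hbj⟩) (j := ⟨s, hSj s hs⟩)
      fun h => hb (by rw [Subtype.mk.injEq] at h; exact h ▸ hs)
  have hxS : x ∈ convexHull ℝ (S : Set (Vec d)) :=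
    convexHull_mono hinter (𝒯.inter i j ▸ ⟨hxi, hxj⟩)
  have h1 := hzero x hxS
  have h2 : (𝒯.basis j).coord ⟨b, hbj⟩ b = 1 := (𝒯.basis j).coord_apply_eq ⟨b, hbj⟩
  rw [hx, AffineMap.apply_lineMap, AffineMap.lineMap_apply_module, hzero m hmS, h2] at h1
  simp at h1
  linarith

theorem affineMap_eq_sum_coord (j : Fin N) (f : Vec d →ᵃ[ℝ] ℝ) (y : Vec d) :
    f y = ∑ t, (𝒯.basis j).coord t y * f (t : Vec d) := by
  conv_lhs => rw [← (𝒯.basis j).affineCombination_coord_eq_self y]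
  rw [Finset.map_affineCombination _ _ _ ((𝒯.basis j).sum_coord_apply_eq_one y),
    Finset.affineCombination_eq_linear_combination _ _ _ ((𝒯.basis j).sum_coord_apply_eq_one y)]
  rfl

/-- For neighbouring cells, `opposite` is the vertex not shared. -/
theorem vert_sdiff_eq {i j : Fin N} (h : (𝒯.vert i ∩ 𝒯.vert j).card = d) :
    𝒯.vert i \ 𝒯.vert j = {𝒯.opposite i j} := by
  have hc : (𝒯.vert i \ 𝒯.vert j).card = 1 := by
    have := Finset.card_sdiff_add_card_inter (𝒯.vert i) (𝒯.vert j)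
    rw [𝒯.card_vert, h] at this
    omega
  obtain ⟨a, ha⟩ := Finset.card_eq_one.1 hc
  rw [opposite, ha, Finset.sum_singleton]

theorem opposite_mem {i j : Fin N} (h : (𝒯.vert i ∩ 𝒯.vert j).card = d) :
    𝒯.opposite i j ∈ 𝒯.vert i := by
  have : 𝒯.opposite i j ∈ 𝒯.vert i \ 𝒯.vert j := by
    rw [vert_sdiff_eq h]; exact Finset.mem_singleton_self _
  exact (Finset.mem_sdiff.1 this).1

theorem vert_eq_insert {i j : Fin N} (h : (𝒯.vert i ∩ 𝒯.vert j).card = d) :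
    𝒯.vert i = insert (𝒯.opposite i j) (𝒯.vert i ∩ 𝒯.vert j) ∧
      𝒯.opposite i j ∉ 𝒯.vert i ∩ 𝒯.vert j := by
  have h1 := vert_sdiff_eq h
  have h2 : 𝒯.opposite i j ∈ 𝒯.vert i \ 𝒯.vert j := h1 ▸ Finset.mem_singleton_self _
  refine ⟨?_, fun h3 => (Finset.mem_sdiff.1 h2).2 (Finset.mem_inter.1 h3).2⟩
  rw [Finset.insert_eq, ← h1, Finset.sdiff_union_inter]

/-- A facet of a cell is shared with at most one other cell. -/
theorem opposite_injective (hd : 0 < d) {i j j' : Fin N} (hij : i ≠ j) (hij' : i ≠ j')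
    (h : (𝒯.vert i ∩ 𝒯.vert j).card = d) (h' : (𝒯.vert i ∩ 𝒯.vert j').card = d)
    (heq : 𝒯.opposite i j = 𝒯.opposite i j') : j = j' := by
  by_contra hjj
  set S := 𝒯.vert i ∩ 𝒯.vert j with hS
  have hSS : 𝒯.vert i ∩ 𝒯.vert j' = S := by
    ext x
    have := Finset.ext_iff.1 ((vert_sdiff_eq h).trans (heq ▸ (vert_sdiff_eq h').symm)) x
    simp only [hS, Finset.mem_sdiff, Finset.mem_inter] at this ⊢
    tauto
  have hne : S.Nonempty := Finset.card_pos.1 (h.symm ▸ hd)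
  obtain ⟨hi, ha⟩ := vert_eq_insert h
  have hji : (𝒯.vert j ∩ 𝒯.vert i).card = d := by rw [Finset.inter_comm]; exact h
  have hji' : (𝒯.vert j' ∩ 𝒯.vert i).card = d := by rw [Finset.inter_comm]; exact h'
  obtain ⟨hj, hb⟩ := vert_eq_insert hji
  obtain ⟨hj', hb'⟩ := vert_eq_insert hji'
  rw [Finset.inter_comm, ← hS] at hj hb
  rw [Finset.inter_comm, hSS] at hj' hb'
  rw [← hS] at hi ha
  set a := 𝒯.opposite i j
  set b := 𝒯.opposite j i
  set b' := 𝒯.opposite j' i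
  have hai : a ∈ 𝒯.vert i := opposite_mem h
  have hbj : b ∈ 𝒯.vert j := opposite_mem hji
  have n1 := coord_neg hij ha hb hne hi hj hai
  have n2 := coord_neg hij' ha hb' hne hi hj' hai
  have n3 := coord_neg hjj hb hb' hne hj hj' hbj
  -- The `a`-coordinate of cell `i` vanishes on `S`, so at `b'` it is the `b`-coordinate of `b'`
  -- times its value at `b`. Both factors are negative, while the result must be negative: three
  -- cells cannot pairwise lie on opposite sides of one facet.
  have key := affineMap_eq_sum_coord (𝒯 := 𝒯) j ((𝒯.basis i).coord ⟨a, hai⟩) b'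
  rw [Finset.sum_eq_single ⟨b, hbj⟩ (fun t _ htb => ?_) (by simp)] at key
  · have := mul_pos_of_neg_of_neg n3 n1
    linarith
  · have htS : (t : Vec d) ∈ S := by
      have := Finset.mem_insert.1 ((Finset.ext_iff.1 hj t).1 t.2)
      exact this.resolve_left fun h => htb (Subtype.ext h)
    have hti : (t : Vec d) ∈ 𝒯.vert i := hi ▸ Finset.mem_insert_of_mem htS
    have : (𝒯.basis i).coord ⟨a, hai⟩ (t : Vec d) = 0 :=
      (𝒯.basis i).coord_apply_ne (i := ⟨a, hai⟩) (j := ⟨t, hti⟩)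
        fun h => ha (by rw [Subtype.mk.injEq] at h; exact h ▸ htS)
    rw [this, mul_zero]

end Triangulation

/-! ### Locality of the facet degrees of freedom -/

/-- If of two piecewise polynomial fields one vanishes at almost every point, then on each cell
one of them vanishes. -/
theorem eqOn_zero_or_eqOn_zero (hd : 0 < d) {m n : ℕ} {u v : Vec d → Vec d}
    (hu : HasPolyDiv 𝒯 m u) (hv : HasPolyDiv 𝒯 n v)
    (h : ∀ᵐ x ∂(volume.restrict Ω), u x = 0 ∨ v x = 0) (i : Fin N) :
    (∀ x ∈ interior (𝒯.cell i), u x = 0) ∨ ∀ x ∈ interior (𝒯.cell i), v x = 0 := by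
  obtain ⟨P, -, hP⟩ := hu i
  obtain ⟨Q, -, hQ⟩ := hv i
  by_cases hP0 : ∀ j, P j = 0
  · left
    intro x hx
    ext j
    simp [hP x hx j, hP0 j, polyFun]
  by_cases hQ0 : ∀ j, Q j = 0
  · right
    intro x hx
    ext j
    simp [hQ x hx j, hQ0 j, polyFun]
  exfalso
  push Not at hP0 hQ0
  obtain ⟨j, hj⟩ := hP0
  obtain ⟨l, hl⟩ := hQ0
  -- With a nonzero component on either side, both fields are nonzero almost everywhere on the cell,
  -- so the cell would be a null set.
  have hae : ∀ᵐ x, x ∉ interior (𝒯.cell i) := by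
    filter_upwards [ae_polyFun_ne_zero hd _ hj, ae_polyFun_ne_zero hd _ hl,
      𝒯.ae_interior_of_restrict h i] with x h1 h2 h3 hx
    rcases h3 hx with h | h
    · exact h1 (by rw [← hP x hx j, h]; rfl)
    · exact h2 (by rw [← hQ x hx l, h]; rfl)
  exact (isOpen_interior.measure_pos volume (𝒯.nonempty_interior_cell i)).ne'
    (measure_eq_zero_iff_ae_notMem.2 hae)

/-- A lowest order Raviart--Thomas field on a cell with vanishing normal trace is zero. -/
theorem HasDiv0.eq_zero_of_affine (hd : 0 < d) {i : Fin N} {w : Vec d → Vec d}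
    (hw : HasDiv0 (interior (𝒯.cell i)) w) {B : ℝ} {c : Vec d}
    (h : ∀ x ∈ interior (𝒯.cell i), w x = B • x + c) : B = 0 ∧ c = 0 := by
  have hbdd : Bornology.IsBounded (interior (𝒯.cell i)) :=
    (𝒯.isCompact_cell i).isBounded.subset interior_subset
  have hvol : volume.real (interior (𝒯.cell i)) ≠ 0 :=
    (ENNReal.toReal_pos (isOpen_interior.measure_pos volume (𝒯.nonempty_interior_cell i)).ne'
      hbdd.measure_lt_top.ne).ne'
  have hm : MeasurableSet (interior (𝒯.cell i)) := isOpen_interior.measurableSet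
  have hdiv : ∀ x ∈ interior (𝒯.cell i), pwDiv w x = d * B := fun x hx => by
    rw [pwDiv_eqOn isOpen_interior (P := fun x => B • x + c) h hx, pwDiv]
    have : fderiv ℝ (fun x : Vec d => B • x + c) x = B • ContinuousLinearMap.id ℝ (Vec d) := by
      rw [fderiv_add_const, fderiv_fun_const_smul (by fun_prop)]
      simp
    rw [this]; simp
  -- The divergence is the constant `d B`, and its integral over the cell is zero.
  have hB : B = 0 := by
    have h1 := hw.integral_pwDiv_eq_zero hm hbdd
    rw [setIntegral_congr_fun hm hdiv] at h1
    simp only [setIntegral_const, smul_eq_mul, mul_eq_zero, hvol, false_or, Nat.cast_eq_zero] at h1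
    exact h1.resolve_left hd.ne'
  refine ⟨hB, ?_⟩
  obtain ⟨φ, hφ, hφs, h1⟩ := exists_cutoff hbdd
  have hl : ContDiff ℝ ∞ fun x : Vec d => ⟪c, x⟫ := (innerSL ℝ c).contDiff
  -- Testing with the linear function `⟪c, x⟫`, cut off outside the cell, leaves `‖c‖²` times the
  -- volume equal to zero.
  have key := hw (fun x => φ x * ⟪c, x⟫) (hφ.mul hl) hφs.mul_right
  have e1 : ∀ x ∈ interior (𝒯.cell i), fderiv ℝ (fun x => φ x * ⟪c, x⟫) x (w x) = ‖c‖ ^ 2 := by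
    intro x hx
    have hlf : HasFDerivAt (fun x : Vec d => ⟪c, x⟫) (innerSL ℝ c) x := (innerSL ℝ c).hasFDerivAt
    rw [((hφ.differentiable (by simp) x).hasFDerivAt.fun_mul hlf).fderiv, (h1 x hx).1,
      (h1 x hx).2, h x hx, hB]
    simp
  have e2 : ∀ x ∈ interior (𝒯.cell i), pwDiv w x * (φ x * ⟪c, x⟫) = 0 := fun x hx => by
    rw [hdiv x hx, hB]; simp
  rw [setIntegral_congr_fun hm e1, setIntegral_congr_fun hm e2] at key
  simpa [hvol] using key

/-- The neighbour of the cell `i` across the facet `F`. -/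
def facetNeighbour (i : Fin N) (F : Fin N × Fin N) : Fin N := if F.1 = i then F.2 else F.1

/-- The lowest order degrees of freedom vanish on the facets of a cell on which the field is
zero. -/
theorem IsRT0Dof.eq_zero (hd : 0 < d) {k : ℕ} {v : Vec d → Vec d}
    {c : Fin N × Fin N → ℝ} (hc : IsRT0Dof 𝒯 k v c) {i : Fin N}
    (h0 : ∀ x ∈ interior (𝒯.cell i), v x = 0) {F : Fin N × Fin N} (hF : F ∈ 𝒯.interiorFacets)
    (hFi : F.1 = i ∨ F.2 = i) : c F = 0 := by
  set Fi := 𝒯.interiorFacets.filter fun F => F.1 = i ∨ F.2 = i with hFidef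
  have hnb : ∀ F ∈ Fi, i ≠ facetNeighbour i F ∧
      (𝒯.vert i ∩ 𝒯.vert (facetNeighbour i F)).card = d := by
    intro F hF
    simp only [hFidef, Triangulation.interiorFacets, Finset.mem_filter, Finset.mem_univ,
      true_and] at hF
    obtain ⟨⟨hlt, hcard⟩, h⟩ := hF
    unfold facetNeighbour
    split_ifs with h1
    · subst h1; exact ⟨hlt.ne, hcard⟩
    · have h2 := h.resolve_left h1
      subst h2; exact ⟨hlt.ne', by rw [Finset.inter_comm]; exact hcard⟩
  have hvolc : volume.real (𝒯.cell i) ≠ 0 := by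
    refine (ENNReal.toReal_pos ?_ (𝒯.isCompact_cell i).measure_lt_top.ne).ne'
    exact ((isOpen_interior.measure_pos volume (𝒯.nonempty_interior_cell i)).trans_le
      (measure_mono interior_subset)).ne'
  set κ : ℝ := (d * volume.real (𝒯.cell i))⁻¹ with hκ
  have hκ0 : κ ≠ 0 := inv_ne_zero (mul_ne_zero (by exact_mod_cast hd.ne') hvolc)
  set o : Fin N × Fin N → Vec d := fun F => 𝒯.opposite i (facetNeighbour i F) with ho
  set β : Fin N × Fin N → ℝ := fun F => c F * ((if F.1 = i then 1 else -1) * κ) with hβ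
  have hψ : ∀ x ∈ interior (𝒯.cell i), ∑ F ∈ 𝒯.interiorFacets, c F • rt0Basis 𝒯 F x =
      ∑ F ∈ Fi, β F • (x - o F) := by
    intro x hx
    rw [hFidef, Finset.sum_filter]
    refine Finset.sum_congr rfl fun F hF => ?_
    have hother : ∀ j, j ≠ i → x ∉ interior (𝒯.cell j) := fun j hj hxj =>
      Set.disjoint_left.1 (𝒯.disjoint_interior hj) hxj hx
    unfold rt0Basis
    by_cases h1 : F.1 = i
    · rw [h1, if_pos hx, if_pos (Or.inl rfl)]
      simp only [hβ, ho, facetNeighbour, h1, if_true, one_mul, mul_smul, hκ]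
    · rw [if_neg (hother _ h1)]
      by_cases h2 : F.2 = i
      · rw [h2, if_pos hx, if_pos (Or.inr rfl)]
        simp only [hβ, ho, facetNeighbour, h1, if_false, neg_mul, one_mul, mul_smul, neg_smul, hκ]
      · rw [if_neg (hother _ h2), if_neg (by tauto), smul_zero]
  have hbub : HasDiv0 (interior (𝒯.cell i))
      (v - ∑ F ∈ 𝒯.interiorFacets, c F • rt0Basis 𝒯 F) :=
    (hc.2 i).hasDiv0_cell hc.1.hasPolyDiv.pw
  -- Where `v = 0`, the bubble is minus the lowest order part, thus of the form `B x + c` with zero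
  -- normal trace. Its vanishing gives `∑ β = 0` and `∑ β o = 0`.
  have hzero := hbub.eq_zero_of_affine hd (B := -∑ F ∈ Fi, β F) (c := ∑ F ∈ Fi, β F • o F) (by
    intro x hx
    have := hψ x hx
    simp only [Pi.sub_apply, Finset.sum_apply, Pi.smul_apply, h0 x hx, this, smul_sub,
      Finset.sum_sub_distrib, ← Finset.sum_smul]
    rw [neg_smul]; abel)
  have hmem : ∀ F ∈ Fi, o F ∈ 𝒯.vert i := fun F hF => Triangulation.opposite_mem (hnb F hF).2
  let f : Fi → 𝒯.vert i := fun F => ⟨o F, hmem F F.2⟩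
  have hf : Function.Injective f := by
    intro F F' hFF
    have hFo : o F = o F' := congrArg Subtype.val hFF
    have h1 := Triangulation.opposite_injective hd (hnb F F.2).1 (hnb F' F'.2).1 (hnb F F.2).2
      (hnb F' F'.2).2 hFo
    have m1 := F.2
    have m2 := F'.2
    simp only [hFidef, Triangulation.interiorFacets, Finset.mem_filter, Finset.mem_univ,
      true_and] at m1 m2
    have l1 := m1.1.1
    have l2 := m2.1.1
    unfold facetNeighbour at h1
    apply Subtype.ext
    -- The neighbour determines the facet, since the pair of cell indices is ordered.
    apply Prod.ext <;> grind
  have hind := (𝒯.affineIndependent i).comp_embedding ⟨f, hf⟩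
  -- The two relations are an affine dependence among distinct vertices of a nondegenerate simplex,
  -- so every `β F` is zero.
  have hall := affineIndependent_iff.1 hind Finset.univ (fun F => β F)
    (by rw [Finset.sum_coe_sort Fi β]; exact neg_eq_zero.1 hzero.1)
    (by
      have := Finset.sum_coe_sort Fi fun F => β F • o F
      rw [hzero.2] at this
      exact this)
  have hFm : F ∈ Fi := Finset.mem_filter.2 ⟨hF, hFi⟩
  have := hall ⟨F, hFm⟩ (Finset.mem_univ _)
  simp only [hβ, mul_eq_zero, hκ0, or_false] at this
  refine this.resolve_right ?_
  split_ifs <;> norm_num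

/-- Every admissible coefficient vector vanishes there, so the choice made in `dof` is immaterial.
-/
theorem dof_eq_zero (hd : 0 < d) {k : ℕ} {v : Vec d → Vec d} {i : Fin N}
    (h0 : ∀ x ∈ interior (𝒯.cell i), v x = 0) {F : Fin N × Fin N} (hF : F ∈ 𝒯.interiorFacets)
    (hFi : F.1 = i ∨ F.2 = i) : dof 𝒯 k v F = 0 := by
  unfold dof
  split_ifs with h
  · exact h.choose_spec.eq_zero hd h0 hF hFi
  · rfl

/-- For each facet it suffices to look at one adjacent cell, on which one of the two fields is
identically zero. -/
theorem aD_eq_zero (hd : 0 < d) {k m n : ℕ} (α : ℝ) {u v : Vec d → Vec d}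
    (hu : HasPolyDiv 𝒯 m u) (hv : HasPolyDiv 𝒯 n v)
    (h : ∀ᵐ x ∂(volume.restrict Ω), u x = 0 ∨ v x = 0) : aD 𝒯 k α u v = 0 := by
  unfold aD
  rw [Finset.sum_eq_zero, mul_zero]
  intro F hF
  rcases eqOn_zero_or_eqOn_zero hd hu hv h F.1 with h0 | h0
  · rw [dof_eq_zero hd h0 hF (Or.inl rfl)]; ring
  · rw [dof_eq_zero hd h0 hF (Or.inl rfl)]; ring

theorem stab_eq_zero {u u' v : Pair d} (S : StabKind)
    (h : ∀ᵐ x ∂(volume.restrict Ω), v.2 x = 0 ∨ (u.2 x = 0 ∧ u'.2 x = 0)) :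
    stab 𝒯 u u' v S = 0 := by
  cases S with
  | S1 =>
    refine integral_eq_zero_of_ae ?_
    filter_upwards [h] with x hx
    rcases hx with hx | hx <;> simp [hx]
  | S2 =>
    refine Finset.sum_eq_zero fun i _ => mul_eq_zero_of_right _ (integral_eq_zero_of_ae ?_)
    rw [EventuallyEq, ae_restrict_iff' (𝒯.isCompact_cell i).measurableSet]
    filter_upwards [𝒯.ae_mem_cell, 𝒯.ae_interior_of_restrict h i] with x h1 h2 hx
    rcases h2 (h1 hx) with hx | hx <;> simp [hx]

/-! ### Testing with a rigid body velocity -/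

/-- The momentum balance tested with a rigid body velocity. -/
theorem ip_eq_of_momentum (hd : 0 < d) (hΩ : MeasurableSet Ω) {k : ℕ}
    {W : Submodule ℝ (Vec d → Vec d)} (hW : IsBubbleComplement 𝒯 (k - 1) W)
    {Qhat : Submodule ℝ (Vec d → ℝ)} {ν α γ : ℝ} {S : StabKind} {u u' v : Pair d}
    (hu : u ∈ Vh 𝒯 k W Qhat) (hv : v ∈ Vh 𝒯 k W Qhat) {p : Vec d → ℝ} {f : Vec d → Vec d}
    {Ω₀ : Set (Vec d)} {A : Vec d →L[ℝ] Vec d} (hA : ∀ y, ⟪A y, y⟫ = 0) {b : Vec d}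
    (hv0 : ∀ᵐ x ∂(volume.restrict Ω), x ∈ Ω₀ → v.1 x = A x + b ∧ v.2 x = 0)
    (hu0 : ∀ᵐ x ∂(volume.restrict Ω), x ∉ Ω₀ → u.1 x = 0 ∧ u.2 x = 0 ∧ u'.1 x = 0 ∧ u'.2 x = 0 ∧
      p x = 0 ∧ f x = 0)
    (hmom : dh Ω u' v + cVol Ω u u v + γ * stab 𝒯 u u' v S + ν * ah 𝒯 k α u v + bForm Ω v p =
      ip Ω f v.s)
    (hmass : ∀ q ∈ Qh 𝒯 k, bForm Ω u q = 0) :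
    ip Ω u'.s (fun x => A x + b) = ip Ω f fun x => A x + b := by
  obtain ⟨hu1, hu2⟩ := hu
  obtain ⟨hv1, hv2⟩ := hv
  have pu1 := Vct.hasPolyDiv hu1
  have pv1 := Vct.hasPolyDiv hv1
  obtain ⟨pu2, du2⟩ := VR.props hW hu2
  obtain ⟨pv2, dv2⟩ := VR.props hW hv2
  have qu1 := pu1.pw
  have qu2 := pu2.pw
  have qv1 := pv1.pw
  have qv2 := pv2.pw
  have qus : Pw 𝒯 u.s := qu1.add qu2
  have hgp : Pw 𝒯 fun x => A x + b := ContDiff.pw (by fun_prop)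
  have hus : HasDiv0 Ω u.s := (MemH10.hasDiv0 hu1.2 qu1).add du2 qu1 qu2
  have hdiv : ∀ᵐ x ∂(volume.restrict Ω), pwDiv u.s x = 0 :=
    ae_pwDiv_eq_zero hΩ (pu1.add pu2) hus fun q hq => neg_eq_zero.1 (hmass q hq)
  have hDv := qv1.ae_eq_affine hd A b
  have hDv2 := qv2.ae_fderiv_eq_zero hd
  have hDu := qu1.ae_eq_affine hd 0 0
  -- The pointwise alternative, including derivatives, from which each term is evaluated. It needs
  -- no measurability or regularity of `Ω₀`.
  have loc : ∀ᵐ x ∂(volume.restrict Ω),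
      (v.1 x = A x + b ∧ v.2 x = 0 ∧ fderiv ℝ v.1 x = A ∧ Laplacian.laplacian v.1 x = 0 ∧
        pwDiv v.s x = 0) ∨
      (u.1 x = 0 ∧ u.2 x = 0 ∧ u'.1 x = 0 ∧ u'.2 x = 0 ∧ p x = 0 ∧ f x = 0 ∧
        fderiv ℝ u.1 x = 0 ∧ Laplacian.laplacian u.1 x = 0) := by
    filter_upwards [hv0, hu0, hDv, hDv2, hDu, 𝒯.ae_mem_interior] with x h1 h2 h3 h4 h5 ⟨i, hx⟩
    by_cases hx0 : x ∈ Ω₀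
    · left
      obtain ⟨e1, e2⟩ := h1 hx0
      obtain ⟨e3, e4⟩ := h3 e1
      refine ⟨e1, e2, e3, e4, ?_⟩
      have : pwDiv v.s x = pwDiv v.1 x + pwDiv v.2 x := pwDiv_add qv1 qv2 hx
      rw [this, pwDiv, pwDiv, e3, h4 e2]
      simp only [_root_.zero_apply, PiLp.zero_apply, Finset.sum_const_zero, add_zero]
      -- The diagonal entries of the skew map `A` are zero.
      refine Finset.sum_eq_zero fun j _ => ?_
      simpa [EuclideanSpace.inner_single_right] using hA (EuclideanSpace.single j 1)
    · right
      obtain ⟨e1, e2, e3, e4, e5, e6⟩ := h2 hx0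
      obtain ⟨e7, e8⟩ := h5 (by simpa using e1)
      exact ⟨e1, e2, e3, e4, e5, e6, e7, e8⟩
  have t1 : dh Ω u' v = ip Ω u'.s fun x => A x + b := by
    refine integral_congr_ae ?_
    filter_upwards [loc] with x hx
    rcases hx with ⟨e1, e2, -⟩ | ⟨-, -, e3, e4, -⟩
    · simp [Pair.s, e1, e2]
    · simp [Pair.s, e3, e4]
  have t2 : ip Ω f v.s = ip Ω f fun x => A x + b := by
    refine integral_congr_ae ?_
    filter_upwards [loc] with x hx
    rcases hx with ⟨e1, e2, -⟩ | ⟨-, -, -, -, -, e6, -⟩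
    · simp [Pair.s, e1, e2]
    · simp [e6]
  have t3 : bForm Ω v p = 0 := by
    refine neg_eq_zero.2 (integral_eq_zero_of_ae ?_)
    filter_upwards [loc] with x hx
    rcases hx with ⟨-, -, -, -, e5⟩ | ⟨-, -, -, -, e5, -⟩ <;> simp [e5]
  have t4 : stab 𝒯 u u' v S = 0 := by
    refine stab_eq_zero S ?_
    filter_upwards [loc] with x hx
    rcases hx with ⟨-, e2, -⟩ | ⟨-, e2, -, e4, -⟩
    · exact Or.inl e2
    · exact Or.inr ⟨e2, e4⟩
  have t5 : cVol Ω u u v = 0 := by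
    have c1 : cForm Ω u.s u.1 v.s = ∫ x in Ω, ⟪fderiv ℝ u.1 x (u.s x), A x + b⟫ := by
      refine integral_congr_ae ?_
      filter_upwards [loc] with x hx
      rcases hx with ⟨e1, e2, -⟩ | ⟨-, -, -, -, -, -, e7, -⟩
      · simp [Pair.s, e1, e2]
      · simp [e7]
    have c2 : cForm Ω u.s v.1 u.2 = ∫ x in Ω, ⟪u.2 x, A (u.s x)⟫ := by
      refine integral_congr_ae ?_
      filter_upwards [loc] with x hx
      rcases hx with ⟨-, -, e3, -⟩ | ⟨-, e2, -⟩
      · simp only [e3]; exact real_inner_comm _ _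
      · simp [e2]
    have c3 : ∫ x in Ω, ⟪fderiv ℝ u.1 x (u.s x), A x + b⟫ = - ∫ x in Ω, ⟪u.1 x, A (u.s x)⟫ := by
      refine integral_convect_eq_zero hu1.2 qu1 qus (fun φ hφ hφs _ => ?_) A b
      rw [hus φ hφ hφs, neg_eq_zero]
      refine integral_eq_zero_of_ae ?_
      filter_upwards [hdiv] with x hx
      simp [hx]
    have qA : Pw 𝒯 fun x => A (u.s x) := qus.comp A.contDiff
    -- The components `u^ct` and `u^R` recombine to `u^s`, paired with `A u^s`.
    rw [cVol, c1, c2, c3, ← neg_add', neg_eq_zero,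
      ← integral_add (qu1.inner qA).integrable (qu2.inner qA).integrable]
    refine integral_eq_zero_of_ae (Eventually.of_forall fun x => ?_)
    simp only [← inner_add_left, Pi.zero_apply]
    rw [real_inner_comm]
    exact hA (u.s x)
  have t6 : ah 𝒯 k α u v = 0 := by
    have a1 : gradIp Ω u.1 v.1 = 0 := by
      have : gradIp Ω u.1 v.1 = ∫ x in Ω, ∑ j,
          ⟪fderiv ℝ u.1 x (EuclideanSpace.single j 1), A (EuclideanSpace.single j 1)⟫ := by
        refine integral_congr_ae ?_
        filter_upwards [loc] with x hx
        rcases hx with ⟨-, -, e3, -⟩ | ⟨-, -, -, -, -, -, e7, -⟩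
        · simp only [e3]
        · simp [e7]
      rw [this, integral_finsetSum]
      · refine Finset.sum_eq_zero fun j _ => ?_
        -- Here the convecting field is the constant `e_j` and the affine field the constant `A
        -- e_j`, with linear part zero, so the right-hand side vanishes.
        have := integral_convect_eq_zero hu1.2 qu1 (w := fun _ => EuclideanSpace.single j 1)
          (ContDiff.pw contDiff_const) (fun φ hφ hφs hφΩ => ?_) 0 (A (EuclideanSpace.single j 1))
        · simpa using this
        · rw [setIntegral_eq_of_tsupport hφΩ fun x hx => by
            rw [fderiv_eq_zero_of_notMem_tsupport hx]; rfl]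
          rw [integral_fderiv_apply_eq_neg (v := fun _ => EuclideanSpace.single j 1)
            contDiff_const hφ (Or.inl hφs)]
          simp [pwDiv]
      · exact fun j _ => (Pw.inner (qu1.fderiv.clm_apply (ContDiff.pw contDiff_const))
          (ContDiff.pw contDiff_const)).integrable
    have a2 : ip Ω (Laplacian.laplacian u.1) v.2 = 0 := by
      refine integral_eq_zero_of_ae ?_
      filter_upwards [loc] with x hx
      rcases hx with ⟨-, e2, -⟩ | ⟨-, -, -, -, -, -, -, e8⟩
      · simp [e2]
      · simp [e8]
    have a3 : ip Ω (Laplacian.laplacian v.1) u.2 = 0 := by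
      refine integral_eq_zero_of_ae ?_
      filter_upwards [loc] with x hx
      rcases hx with ⟨-, -, -, e4, -⟩ | ⟨-, e2, -⟩
      · simp [e4]
      · simp [e2]
    have a4 : aD 𝒯 k α u.2 v.2 = 0 := by
      refine aD_eq_zero hd α pu2 pv2 ?_
      filter_upwards [loc] with x hx
      rcases hx with ⟨-, e2, -⟩ | ⟨-, e2, -⟩
      · exact Or.inr e2
      · exact Or.inl e2
    rw [ah, a1, a2, a3, a4]; ring
  rw [t3, t4, t5, t6] at hmom
  rw [← t1, ← t2, ← hmom]; ring

/-! ### Absolutely continuous curves -/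

theorem absolutelyContinuousOnInterval_congr {X : Type*} [PseudoMetricSpace X] {f g : ℝ → X}
    {a b : ℝ} (hf : AbsolutelyContinuousOnInterval f a b) (h : Set.EqOn f g (Set.uIcc a b)) :
    AbsolutelyContinuousOnInterval g a b := by
  rw [absolutelyContinuousOnInterval_iff] at hf ⊢
  intro ε hε
  obtain ⟨δ, hδ, H⟩ := hf ε hε
  refine ⟨δ, hδ, fun E hE hsum => ?_⟩
  convert H E hE hsum using 2 with i hi
  have := hE.1 i hi
  rw [h this.1, h this.2]

theorem absolutelyContinuousOnInterval_sum_smul {n : ℕ} {F : Type*} [NormedAddCommGroup F]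
    [NormedSpace ℝ F] {c : Fin n → ℝ → ℝ} {a b : ℝ}
    (hc : ∀ j, AbsolutelyContinuousOnInterval (c j) a b) (y : Fin n → F) :
    AbsolutelyContinuousOnInterval (fun t => ∑ j, c j t • y j) a b := by
  have key : ∀ s : Finset (Fin n),
      AbsolutelyContinuousOnInterval (fun t => ∑ j ∈ s, c j t • y j) a b := by
    intro s
    induction s using Finset.induction_on with
    | empty =>
      simpa using (contDiffOn_const (c := (0 : F))).absolutelyContinuousOnInterval
    | insert j s hj ih =>
      simp only [Finset.sum_insert hj]
      have hy := (contDiffOn_const (c := y j) (s := Set.uIcc a b)).absolutelyContinuousOnInterval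
      exact ((hc j).fun_smul hy).fun_add ih
  exact key _

theorem _root_.HasDerivAt.mem_of_eventually_mem {E : Type*} [NormedAddCommGroup E]
    [NormedSpace ℝ E] {c : ℝ → E} {c' : E} {t : ℝ} (h : HasDerivAt c c' t) {Z : Submodule ℝ E}
    (hZ : IsClosed (Z : Set E)) (hc : ∀ᶠ s in 𝓝 t, c s ∈ Z) : c' ∈ Z := by
  refine hZ.mem_of_tendsto (hasDerivAt_iff_tendsto_slope.1 h) ?_
  filter_upwards [hc.filter_mono nhdsWithin_le_nhds] with s hs
  rw [slope_def_module]
  exact Z.smul_mem _ (Z.sub_mem hs hc.self_of_nhds)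

/-- A subspace that contains a continuous curve at almost every time contains its derivatives. -/
theorem deriv_mem_of_ae_mem {E : Type*} [NormedAddCommGroup E] [NormedSpace ℝ E] {c : ℝ → E}
    {T : ℝ} (hc : ContinuousOn c (Set.Ioo 0 T)) {Z : Submodule ℝ E} (hZ : IsClosed (Z : Set E))
    (h : ∀ᵐ t ∂(volume.restrict (Set.Ioc 0 T)), c t ∈ Z) {t : ℝ} (ht : t ∈ Set.Ioo 0 T) {c' : E}
    (hc' : HasDerivAt c c' t) : c' ∈ Z := by
  -- The times at which the curve is outside `Z` form an open null set, hence there are none.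
  have hopen := hc.isOpen_inter_preimage isOpen_Ioo hZ.isOpen_compl
  have hnull : volume (Set.Ioo 0 T ∩ c ⁻¹' (Z : Set E)ᶜ) = 0 := by
    rw [measure_eq_zero_iff_ae_notMem]
    rw [ae_restrict_iff' measurableSet_Ioc] at h
    filter_upwards [h] with s hs hs'
    exact hs'.2 (hs ⟨hs'.1.1, hs'.1.2.le⟩)
  have hempty := hopen.measure_eq_zero_iff volume |>.1 hnull
  refine hc'.mem_of_eventually_mem hZ ?_
  filter_upwards [isOpen_Ioo.mem_nhds ht] with s hs
  by_contra hn
  exact (Set.eq_empty_iff_forall_notMem.1 hempty s) ⟨hs, hn⟩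

theorem sum_smul_fst {n : ℕ} (a : Fin n → ℝ) (φ : Fin n → Pair d) (x : Vec d) :
    (∑ j, a j • φ j).1 x = ∑ j, a j • (φ j).1 x := by
  simp [Prod.fst_sum]

theorem sum_smul_snd {n : ℕ} (a : Fin n → ℝ) (φ : Fin n → Pair d) (x : Vec d) :
    (∑ j, a j • φ j).2 x = ∑ j, a j • (φ j).2 x := by
  simp [Prod.snd_sum]

theorem sum_smul_s {n : ℕ} (a : Fin n → ℝ) (φ : Fin n → Pair d) (x : Vec d) :
    (∑ j, a j • φ j).s x = ∑ j, a j • (φ j).s x := by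
  rw [Pair.s, sum_smul_fst, sum_smul_snd, ← Finset.sum_add_distrib]
  simp [Pair.s]

theorem timeDeriv_eq {n : ℕ} {φ : Fin n → Pair d} {c : Fin n → ℝ → ℝ} {u : ℝ → Pair d} {t : ℝ}
    (hc : ∀ j, DifferentiableAt ℝ (c j) t) (hu : ∀ᶠ s in 𝓝 t, u s = ∑ j, c j s • φ j) :
    timeDeriv u t = ∑ j, deriv (c j) t • φ j := by
  have key : ∀ y : Fin n → Vec d,
      HasDerivAt (fun s => ∑ j, c j s • y j) (∑ j, deriv (c j) t • y j) t := fun y =>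
    HasDerivAt.fun_sum fun j _ => (hc j).hasDerivAt.smul_const (y j)
  refine Prod.ext (funext fun x => ?_) (funext fun x => ?_)
  · rw [sum_smul_fst, ← (key _).deriv]
    refine EventuallyEq.deriv_eq (hu.mono fun s hs => ?_)
    simp only [hs, sum_smul_fst]
  · rw [sum_smul_snd, ← (key _).deriv]
    refine EventuallyEq.deriv_eq (hu.mono fun s hs => ?_)
    simp only [hs, sum_smul_snd]

/-! ### Momenta -/

theorem to3_add (x y : Vec d) : to3 (x + y) = to3 x + to3 y := by
  ext i; simp only [to3, Pi.add_apply]; split_ifs <;> simp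

theorem to3_smul (r : ℝ) (x : Vec d) : to3 (r • x) = r • to3 x := by
  ext i; simp only [to3, Pi.smul_apply]; split_ifs <;> simp

theorem of3_add (x y : Fin 3 → ℝ) : of3 d (x + y) = of3 d x + of3 d y := by
  ext i; simp only [of3, PiLp.add_apply]; split_ifs <;> simp

theorem of3_smul (r : ℝ) (x : Fin 3 → ℝ) : of3 d (r • x) = r • of3 d x := by
  ext i; simp only [of3, PiLp.smul_apply]; split_ifs <;> simp

/-- `to3` as a continuous linear map. -/
noncomputable def to3L (d : ℕ) : Vec d →L[ℝ] (Fin 3 → ℝ) :=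
  LinearMap.toContinuousLinearMap
    { toFun := to3, map_add' := to3_add, map_smul' := to3_smul }

/-- The rotation field as a continuous linear map. -/
noncomputable def rotL (d : ℕ) (i : Fin 3) : Vec d →L[ℝ] Vec d :=
  LinearMap.toContinuousLinearMap
    { toFun := rotField d i
      map_add' := fun x y => by simp [rotField, to3_add, of3_add]
      map_smul' := fun r x => by simp [rotField, to3_smul, of3_smul] }

theorem rotL_apply (i : Fin 3) (x : Vec d) : rotL d i x = rotField d i x := rfl

/-- Cyclic symmetry of the triple product. For `d = 2` truncating `x × e_i` loses nothing, as `a`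
has no third component. -/
theorem crossProduct_to3_apply (hd : d = 2 ∨ d = 3) (a x : Vec d) (i : Fin 3) :
    crossProduct (to3 a) (to3 x) i = ⟪a, rotField d i x⟫ := by
  rcases hd with rfl | rfl <;> fin_cases i <;>
    simp [rotField, of3, to3, cross_apply, PiLp.inner_apply, Fin.sum_univ_succ] <;> ring

/-- For planar `x` these products point along the third axis; the corresponding components of the
angular momentum need no test field. -/
theorem rotField_eq_zero (i : Fin 3) (hi : i ≠ 2) (x : Vec 2) : rotField 2 i x = 0 := by
  ext j
  fin_cases i <;> fin_cases j <;> simp_all [rotField, of3, to3, cross_apply]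

theorem inner_rotL_self (hd : d = 2 ∨ d = 3) (i : Fin 3) (y : Vec d) : ⟪rotL d i y, y⟫ = 0 := by
  rw [real_inner_comm, rotL_apply, ← crossProduct_to3_apply hd, cross_self]
  rfl

theorem integrable_cross (hd : d = 2 ∨ d = 3) (𝒯 : Triangulation Ω N) {f : Vec d → Vec d}
    (hf : Integrable f (volume.restrict Ω)) :
    Integrable (fun x => crossProduct (to3 (f x)) (to3 x)) (volume.restrict Ω) := by
  refine Integrable.of_eval fun i => ?_
  have hr : Pw 𝒯 (rotL d i) := (rotL d i).contDiff.pw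
  obtain ⟨C, hC⟩ := hr.exists_bound
  simp only [crossProduct_to3_apply hd, ← rotL_apply]
  refine (hf.norm.mul_const C).mono' (hf.1.inner hr.aestronglyMeasurable) ?_
  filter_upwards [hC] with x hx
  exact (norm_inner_le_norm _ _).trans (by gcongr)

theorem linMom_sum {n : ℕ} (a : Fin n → ℝ) {φ : Fin n → Pair d} (hφ : ∀ j, Pw 𝒯 (φ j).s) :
    linMom Ω (∑ j, a j • φ j) = ∑ j, a j • linMom Ω (φ j) := by
  simp only [linMom, sum_smul_s]
  rw [integral_finsetSum _ fun j _ => ((hφ j).const_smul (a j)).integrable]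
  simp only [integral_smul]

theorem angMom_sum (hd : d = 2 ∨ d = 3) {n : ℕ} (a : Fin n → ℝ) {φ : Fin n → Pair d}
    (hφ : ∀ j, Pw 𝒯 (φ j).s) :
    angMom Ω (∑ j, a j • φ j) = ∑ j, a j • angMom Ω (φ j) := by
  have hpt : ∀ x, crossProduct (to3 ((∑ j, a j • φ j).s x)) (to3 x) =
      ∑ j, a j • crossProduct (to3 ((φ j).s x)) (to3 x) := fun x => by
    have : to3 (∑ j, a j • (φ j).s x) = ∑ j, a j • to3 ((φ j).s x) := by
      refine (map_sum (to3L d) (fun j => a j • (φ j).s x) Finset.univ).trans ?_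
      exact Finset.sum_congr rfl fun j _ => to3_smul _ _
    rw [sum_smul_s, this]; simp
  simp only [angMom, hpt]
  rw [integral_finsetSum _ fun j _ =>
    (integrable_cross hd 𝒯 (hφ j).integrable).fun_smul (a j)]
  simp only [integral_smul]

theorem integral_eq_of_ip_single {v w : Vec d → Vec d} (hv : Integrable v (volume.restrict Ω))
    (hw : Integrable w (volume.restrict Ω))
    (h : ∀ i, ip Ω v (fun _ => EuclideanSpace.single i 1) =
      ip Ω w fun _ => EuclideanSpace.single i 1) : ∫ x in Ω, v x = ∫ x in Ω, w x := by
  have key : ∀ {f : Vec d → Vec d}, Integrable f (volume.restrict Ω) → ∀ i,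
      (∫ x in Ω, f x) i = ip Ω f fun _ => EuclideanSpace.single i 1 := fun {f} hf i => by
    rw [ip]
    have := (EuclideanSpace.proj i : Vec d →L[ℝ] ℝ).integral_comp_comm hf
    simpa [EuclideanSpace.inner_single_right] using this.symm
  ext i
  rw [key hv, key hw, h]

theorem integral_cross_eq_of_ip_rotField (hd : d = 2 ∨ d = 3) {v w : Vec d → Vec d}
    (hv : Integrable (fun x => crossProduct (to3 (v x)) (to3 x)) (volume.restrict Ω))
    (hw : Integrable (fun x => crossProduct (to3 (w x)) (to3 x)) (volume.restrict Ω))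
    (h : ∀ i, ip Ω v (rotField d i) = ip Ω w (rotField d i)) :
    ∫ x in Ω, crossProduct (to3 (v x)) (to3 x) = ∫ x in Ω, crossProduct (to3 (w x)) (to3 x) := by
  have key : ∀ {f : Vec d → Vec d},
      Integrable (fun x => crossProduct (to3 (f x)) (to3 x)) (volume.restrict Ω) → ∀ i,
      (∫ x in Ω, crossProduct (to3 (f x)) (to3 x)) i = ip Ω f (rotField d i) := fun {f} hf i => by
    have := (ContinuousLinearMap.proj i : (Fin 3 → ℝ) →L[ℝ] ℝ).integral_comp_comm hf
    simp only [ContinuousLinearMap.proj_apply, crossProduct_to3_apply hd] at this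
    exact this.symm
  ext i
  rw [key hv, key hw, h]

theorem SupportedOn.ae_eq_zero {F : Type*} [Zero F] {Ω₀ : Set (Vec d)} {v : Vec d → F}
    (h : SupportedOn Ω Ω₀ v) : ∀ᵐ x ∂(volume.restrict Ω), x ∉ Ω₀ → v x = 0 := by
  obtain ⟨K, -, hK, h⟩ := h
  filter_upwards [h] with x hx hx0 using hx fun hxK => hx0 (hK hxK)

/-- Coefficient vectors whose linear combination vanishes outside of `Ω₀`. -/
def supportedCoeffs (Ω Ω₀ : Set (Vec d)) {n : ℕ} (φ : Fin n → Pair d) :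
    Submodule ℝ (Fin n → ℝ) where
  carrier := {a | ∀ᵐ x ∂(volume.restrict Ω), x ∉ Ω₀ →
    ∑ j, a j • (φ j).1 x = 0 ∧ ∑ j, a j • (φ j).2 x = 0}
  zero_mem' := by simp
  add_mem' {a b} ha hb := by
    change ∀ᵐ x ∂(volume.restrict Ω), x ∉ Ω₀ →
      ∑ j, (a + b) j • (φ j).1 x = 0 ∧ ∑ j, (a + b) j • (φ j).2 x = 0
    filter_upwards [ha, hb] with x h1 h2 hx
    simp [add_smul, Finset.sum_add_distrib, h1 hx, h2 hx]
  smul_mem' r a ha := by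
    change ∀ᵐ x ∂(volume.restrict Ω), x ∉ Ω₀ →
      ∑ j, (r • a) j • (φ j).1 x = 0 ∧ ∑ j, (r • a) j • (φ j).2 x = 0
    filter_upwards [ha] with x h1 hx
    simp [mul_smul, ← Finset.smul_sum, h1 hx]

theorem exists_test_field {k : ℕ} {W : Submodule ℝ (Vec d → Vec d)}
    {Qhat : Submodule ℝ (Vec d → ℝ)} {Ω₀ : Set (Vec d)}
    {χ : Lp (Vec d) 2 (volume.restrict Ω) → Pair d} (hχ : ∀ g, χ g ∈ Vh 𝒯 k W Qhat)
    {g : Vec d → Vec d} (hg : ContDiff ℝ ∞ g) (h : Reproduces χ Ω₀ g) :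
    ∃ v ∈ Vh 𝒯 k W Qhat,
      ∀ᵐ x ∂(volume.restrict Ω), x ∈ Ω₀ → v.1 x = g x ∧ v.2 x = 0 :=
  have hm : MemLp g 2 (volume.restrict Ω) := (hg.pw (𝒯 := 𝒯)).memLp 2
  ⟨χ (hm.toLp g), hχ _, h _ hm.coeFn_toLp⟩

end ScottVogelius

/-! ### Balance of linear and angular momentum -/

theorem lemma3p3 {d N k : ℕ} (hd : d = 2 ∨ d = 3) (hk : 1 ≤ k)
    {Ω : Set (Vec d)} (hΩ : IsBoundedLipschitzDomain Ω) (𝒯 : Triangulation Ω N)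
    (W : Submodule ℝ (Vec d → Vec d)) (hW : IsBubbleComplement 𝒯 (k - 1) W)
    (Qhat : Submodule ℝ (Vec d → ℝ)) (hQhat : (Qhat : Set (Vec d → ℝ)) ⊆ Qh 𝒯 k)
    (ν α γ T : ℝ) (hT : 0 < T) (S : StabKind)
    (f : ℝ → Lp (Vec d) 2 (MeasureTheory.volume.restrict Ω))
    (hf : MeasureTheory.MemLp f 2 (MeasureTheory.volume.restrict (Set.Ioc 0 T)))
    (u0 : Pair d) (u : ℝ → Pair d) (p : ℝ → Vec d → ℝ)
    (hu : IsVolSolution 𝒯 k W Qhat ν α γ S T f u0 u p)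
    (Ω₀ : Set (Vec d)) (hΩ₀ : Ω₀ ⊆ Ω)
    (hsupp : ∀ᵐ t ∂(MeasureTheory.volume.restrict (Set.Ioc 0 T)),
      SupportedOn Ω Ω₀ (u t).1 ∧ SupportedOn Ω Ω₀ (u t).2 ∧ SupportedOn Ω Ω₀ (p t) ∧
        SupportedOn Ω Ω₀ (f t))
    (χ : Lp (Vec d) 2 (MeasureTheory.volume.restrict Ω) → Pair d)
    (hχ : ∀ g, χ g ∈ Vh 𝒯 k W Qhat)
    (hχe : ∀ i : Fin d, Reproduces χ Ω₀ (fun _ => EuclideanSpace.single i 1))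
    (hχrot : ∀ i : Fin 3, d = 3 ∨ i = 2 → Reproduces χ Ω₀ (rotField d i)) :
    AbsolutelyContinuousOnInterval (fun t => linMom Ω (u t)) 0 T ∧
    AbsolutelyContinuousOnInterval (fun t => angMom Ω (u t)) 0 T ∧
    ∀ᵐ t ∂(MeasureTheory.volume.restrict (Set.Ioc 0 T)),
      HasDerivAt (fun s => linMom Ω (u s)) (∫ x in Ω, f t x) t ∧
      HasDerivAt (fun s => angMom Ω (u s)) (∫ x in Ω, crossProduct (to3 (f t x)) (to3 x)) t := by
  have hd0 : 0 < d := by omega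
  have hΩm : MeasurableSet Ω := hΩ.isOpen.measurableSet
  have hfin := 𝒯.isFiniteMeasure
  obtain ⟨n, φ, c, hφ, hc, huc⟩ := hu.curve
  have hIcc : Set.uIcc 0 T = Set.Icc 0 T := Set.uIcc_of_le hT.le
  have hpw : ∀ j, Pw 𝒯 (φ j).s := fun j =>
    (Vct.hasPolyDiv (hφ j).1).pw.add (VR.props hW (hφ j).2).1.pw
  have hlin : Set.EqOn (fun t => ∑ j, c j t • linMom Ω (φ j)) (fun t => linMom Ω (u t))
      (Set.Icc 0 T) := fun t ht => by
    simp only [(huc t ht).2, linMom_sum (fun j => c j t) hpw]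
  have hang : Set.EqOn (fun t => ∑ j, c j t • angMom Ω (φ j)) (fun t => angMom Ω (u t))
      (Set.Icc 0 T) := fun t ht => by
    simp only [(huc t ht).2, angMom_sum hd (fun j => c j t) hpw]
  refine ⟨absolutelyContinuousOnInterval_congr
      (absolutelyContinuousOnInterval_sum_smul hc fun j => linMom Ω (φ j)) (hIcc ▸ hlin),
    absolutelyContinuousOnInterval_congr
      (absolutelyContinuousOnInterval_sum_smul hc fun j => angMom Ω (φ j)) (hIcc ▸ hang), ?_⟩
  have hdiff : ∀ᵐ t ∂(volume.restrict (Set.Ioc 0 T)), ∀ j, DifferentiableAt ℝ (c j) t := by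
    rw [ae_all_iff]
    intro j
    rw [ae_restrict_iff' measurableSet_Ioc]
    filter_upwards [(hc j).ae_differentiableAt] with t ht htT
    exact ht (hIcc ▸ ⟨htT.1.le, htT.2⟩)
  -- The representation of `u` is known on `[0, T]` only; at interior times it holds in a
  -- neighbourhood, as the two-sided derivative requires.
  have hIoo : ∀ᵐ t ∂(volume.restrict (Set.Ioc 0 T)), t ∈ Set.Ioo 0 T := by
    rw [ae_restrict_iff' measurableSet_Ioc]
    filter_upwards [measure_eq_zero_iff_ae_notMem.1 (Real.volume_singleton (a := T))] with t ht htT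
    exact ⟨htT.1, lt_of_le_of_ne htT.2 ht⟩
  have hcont : ContinuousOn (fun t j => c j t) (Set.Ioo 0 T) := continuousOn_pi.2 fun j =>
    (hc j).continuousOn.mono (hIcc ▸ Set.Ioo_subset_Icc_self)
  have hZ : ∀ᵐ t ∂(volume.restrict (Set.Ioc 0 T)),
      (fun j => c j t) ∈ supportedCoeffs Ω Ω₀ φ := by
    filter_upwards [hsupp, hIoo] with t ⟨h1, h2, _⟩ ht
    filter_upwards [h1.ae_eq_zero, h2.ae_eq_zero] with x e1 e2 hx
    rw [← sum_smul_fst, ← sum_smul_snd, ← (huc t ⟨ht.1.le, ht.2.le⟩).2]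
    exact ⟨e1 hx, e2 hx⟩
  filter_upwards [hsupp, hdiff, hIoo, hu.momentum, hu.mass]
    with t ⟨s1, s2, s3, s4⟩ hct ht hmom hmass
  have hnear : ∀ᶠ s in 𝓝 t, s ∈ Set.Icc 0 T := Icc_mem_nhds ht.1 ht.2
  have htd : timeDeriv u t = ∑ j, deriv (c j) t • φ j :=
    timeDeriv_eq hct (hnear.mono fun s hs => (huc s hs).2)
  -- `∂_t u` vanishes outside `Ω₀` as well, because a subspace of the finite-dimensional coefficient
  -- space is closed.
  have hder : (fun j => deriv (c j) t) ∈ supportedCoeffs Ω Ω₀ φ :=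
    deriv_mem_of_ae_mem hcont (Submodule.closed_of_finiteDimensional _) hZ ht
      (hasDerivAt_pi.2 fun j => (hct j).hasDerivAt)
  have hu0 : ∀ᵐ x ∂(volume.restrict Ω), x ∉ Ω₀ → (u t).1 x = 0 ∧ (u t).2 x = 0 ∧
      (timeDeriv u t).1 x = 0 ∧ (timeDeriv u t).2 x = 0 ∧ p t x = 0 ∧ f t x = 0 := by
    filter_upwards [s1.ae_eq_zero, s2.ae_eq_zero, s3.ae_eq_zero, s4.ae_eq_zero, hder]
      with x e1 e2 e3 e4 e5 hx
    rw [htd, sum_smul_fst, sum_smul_snd]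
    exact ⟨e1 hx, e2 hx, (e5 hx).1, (e5 hx).2, e3 hx, e4 hx⟩
  have htest : ∀ (A : Vec d →L[ℝ] Vec d) (b : Vec d), (∀ y, ⟪A y, y⟫ = 0) →
      Reproduces χ Ω₀ (fun x => A x + b) →
      ip Ω (timeDeriv u t).s (fun x => A x + b) = ip Ω (f t) fun x => A x + b := by
    intro A b hA hrep
    obtain ⟨v, hv, hv0⟩ := exists_test_field hχ (by fun_prop) hrep
    exact ip_eq_of_momentum hd0 hΩm hW (huc t ⟨ht.1.le, ht.2.le⟩).1 hv hA hv0 hu0 (hmom v hv) hmass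
  have hlinT : ∀ i, ip Ω (timeDeriv u t).s (fun _ => EuclideanSpace.single i 1) =
      ip Ω (f t) fun _ => EuclideanSpace.single i 1 := fun i => by
    simpa using htest 0 (EuclideanSpace.single i 1) (by simp) (by simpa using hχe i)
  have hangT : ∀ i, ip Ω (timeDeriv u t).s (rotField d i) = ip Ω (f t) (rotField d i) := by
    intro i
    by_cases hi : d = 3 ∨ i = 2
    · simpa [rotL_apply] using htest (rotL d i) 0 (inner_rotL_self hd i)
        (by simpa [rotL_apply] using hχrot i hi)
    · push Not at hi
      obtain rfl := hd.resolve_right hi.1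
      simp [ip, rotField_eq_zero i hi.2]
  have hint : Integrable (timeDeriv u t).s (volume.restrict Ω) := by
    have : Pw 𝒯 (timeDeriv u t).s := by
      have hs : (timeDeriv u t).s = fun x => ∑ j, deriv (c j) t • (φ j).s x := by
        ext1 x; rw [htd, sum_smul_s]
      rw [hs]
      exact Pw.sum _ fun j _ => (hpw j).const_smul _
    exact this.integrable
  have hfint : Integrable (f t) (volume.restrict Ω) := (Lp.memLp (f t)).integrable one_le_two
  have hderiv : ∀ {F : Type} [NormedAddCommGroup F] [NormedSpace ℝ F] (y : Fin n → F),
      HasDerivAt (fun s => ∑ j, c j s • y j) (∑ j, deriv (c j) t • y j) t := fun y =>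
    HasDerivAt.fun_sum fun j _ => (hct j).hasDerivAt.smul_const (y j)
  constructor
  · rw [← integral_eq_of_ip_single hint hfint hlinT]
    have h := hderiv fun j => linMom Ω (φ j)
    rw [← linMom_sum (fun j => deriv (c j) t) hpw, ← htd] at h
    exact h.congr_of_eventuallyEq (hnear.mono fun s hs => (hlin hs).symm)
  · rw [← integral_cross_eq_of_ip_rotField hd (integrable_cross hd 𝒯 hint)
      (integrable_cross hd 𝒯 hfint) hangT]
    have h := hderiv fun j => angMom Ω (φ j)
    rw [← angMom_sum hd (fun j => deriv (c j) t) hpw, ← htd] at h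
    exact h.congr_of_eventuallyEq (hnear.mono fun s hs => (hang hs).symm)
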